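/- **Setting.** Let $(\Omega,\mathcal F_T,(\mathcal F_s)_{s=0}^T,\mathbb P)$ be a filtered probability space, $t\in\{0,\dots,T\}$, $p,q\in[1,\infty]$ with $\frac1p+\frac1q=1$. Let $L^p_d(\mathcal F_s)$ be the space of ($\mathbb P$-a.s. classes of) $\mathcal F_s$-measurable $p$-integrable (essentially bounded if $p=\infty$) random vectors in $\mathbb R^d$; $L^p_d(\mathcal F_T)$ carries the norm topology if $p<\infty$ and $\sigma(L^\infty,L^1)$ if $p=\infty$, and $\operatorname{cl}$ and "closed" refer to this topology. Inequalities are componentwise and a.s.; $L^p_d(\mathcal F_s)_+$ is the nonnegative cone. $L^\infty(\mathcal F_t)$ is the space of scalar essentially bounded $\mathcal F_t$-measurable random variables, and $L^\infty(\mathcal F_t)_{++}$ is the interior of its nonnegative cone, i.e. the set of $\lambda\in L^\infty(\mathcal F_t)$ with $\lambda\ge\varepsilon$ a.s. for some real $\varepsilon>0$. For a set $D$ of random vectors, $\lambda D=\{\lambda u:u\in D\}$. Let $\tilde M_t$ be an $\mathcal F_t$-measurable random set whose values are a.s. linear subspaces of $\mathbb R^d$, $M_t=\{u\in L^p_d(\mathcal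 F_t): u\in\tilde M_t \text{ a.s.}\}$, $(M_t)_+=M_t\cap L^p_d(\mathcal F_t)_+$, and assume $(M_t)_+\ne\{0\}$. Put $$\mathcal P(M_t;(M_t)_+)=\{D\subseteq M_t: D=D+(M_t)_+\},\qquad \mathcal G(M_t;(M_t)_+)=\{D\subseteq M_t: D=\operatorname{cl}\operatorname{co}(D+(M_t)_+)\}.$$ **Risk measures.** A function $R_t:L^p_d(\mathcal F_T)\to\mathcal P(M_t;(M_t)_+)$ is a *conditional risk measure* if $R_t(X+m)=R_t(X)-m$ for all $X$ and all $m\in M_t$; $Y-X\in L^p_d(\mathcal F_T)_+$ implies $R_t(Y)\supseteq R_t(X)$; and $\emptyset\ne R_t(0)\ne M_t$. It is *closed* if its graph $\{(X,u)\in L^p_d(\mathcal F_T)\times M_t:u\in R_t(X)\}$ is closed; *conditionally convex* if $R_t(\lambda X+(1-\lambda)Y)\supseteq\lambda R_t(X)+(1-\lambda)R_t(Y)$ for all $X,Y$ and all $\lambda\in L^\infty(\mathcal F_t)$ with $0\le\lambda\le1$; *subadditive* if $R_t(X+Y)\supseteq R_t(X)+R_t(Y)$ for all $X,Y$; *conditionally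 positive homogeneous* if $R_t(\lambda X)=\lambda R_t(X)$ for all $X$ and all $\lambda\in L^\infty(\mathcal F_t)_{++}$; *conditionally coherent* if it is conditionally positive homogeneous and conditionally convex, or conditionally positive homogeneous and subadditive. Let $A_{R_t}=\{X\in L^p_d(\mathcal F_T):0\in R_t(X)\}$. **Dual variables.** For a vector $\mathbb Q=(\mathbb Q_1,\dots,\mathbb Q_d)$ of probability measures on $\mathcal F_T$ with $\mathbb Q_i\ll\mathbb P$, define $\xi^{\mathbb Q}_{t,T}$ componentwise by $$\big(\xi^{\mathbb Q}_{t,T}\big)_i=\prod_{s=t}^{T-1}\frac{\mathbb E[d\mathbb Q_i/d\mathbb P\,|\,\mathcal F_{s+1}]}{\mathbb E[d\mathbb Q_i/d\mathbb P\,|\,\mathcal F_{s}]},$$ each factor being replaced by $1$ where its denominator vanishes, and put $\mathbb E^{\mathbb Q}_t[X]=\mathbb E[\operatorname{diag}(\xi^{\mathbb Q}_{t,T})X\,|\,\mathcal F_t]$, where the conditional expectation of $Z$ is understood componentwise as $\mathbb E[Z^+|\mathcal F_t]-\mathbb E[Z^-|\mathcal F_t]$ (with the value of an infinite $\mathbb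 E[Z^\pm|\mathcal F_t]$ replaced by $0$). Let $$((M_t)_+)^+=\{v\in L^q_d(\mathcal F_t):\mathbb E[v^{\mathsf T}u]\ge0\ \forall u\in(M_t)_+\},\quad M_t^\perp=\{v\in L^q_d(\mathcal F_t):\mathbb E[v^{\mathsf T}u]=0\ \forall u\in M_t\},$$ $G_t(w)=\{x\in L^p_d(\mathcal F_t):\mathbb E[w^{\mathsf T}x]\ge0\}$, and let $\mathcal W^q_t$ be the set of pairs $(\mathbb Q,w)$ with $\mathbb Q$ as above, $w\in((M_t)_+)^+\setminus M_t^\perp$ and $\operatorname{diag}(w)\,\xi^{\mathbb Q}_{t,T}\in L^q_d(\mathcal F_T)_+$. Write $$\tilde F_{(\mathbb Q,w)}[X]=\{u\in M_t:\mathbb E[w^{\mathsf T}\mathbb E^{\mathbb Q}_t[X]]\le\mathbb E[w^{\mathsf T}u]\}$$ (this is the meaning of $(\mathbb E^{\mathbb Q}_t[X]+G_t(w))\cap M_t$). A function $-\alpha_t:\mathcal W^q_t\to\mathcal G(M_t;(M_t)_+)$ is a *penalty function* if $\bigcap_{(\mathbb Q,w)\in\mathcal W_t^q}-\alpha_t(\mathbb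 Q,w)\ne\emptyset$, $-\alpha_t(\mathbb Q,w)\ne M_t$ for at least one $(\mathbb Q,w)\in\mathcal W_t^q$, and $-\alpha_t(\mathbb Q,w)=\operatorname{cl}(-\alpha_t(\mathbb Q,w)+G_t(w))\cap M_t$ for all $(\mathbb Q,w)\in\mathcal W_t^q$. Consider, for a penalty function, the properties $$-\alpha_t(\mathbb Q,w)\supseteq\lambda(-\alpha_t(\mathbb Q,\lambda w))+(1-\lambda)(-\alpha_t(\mathbb Q,(1-\lambda)w))\quad\forall(\mathbb Q,w)\in\mathcal W^q_t,\ \forall\lambda\in L^\infty(\mathcal F_t),\ 0<\lambda<1,\tag{1}$$ $$R_t(X)=\bigcap_{(\mathbb Q,w)\in\mathcal W^q_t}\big[-\alpha_t(\mathbb Q,w)+\tilde F_{(\mathbb Q,w)}[-X]\big]\quad\forall X\in L^p_d(\mathcal F_T),\tag{2}$$ and, for a set $\mathcal W\subseteq\mathcal W_t^q$, the property $$R_t(X)=\bigcap_{(\mathbb Q,w)\in\mathcal W}\tilde F_{(\mathbb Q,w)}[-X]\quad\forall X\in L^p_d(\mathcal F_T).\tag{3}$$ Call $\mathcal W$ *conditionally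 conical in the second variable* if $(\mathbb Q,\lambda w)\in\mathcal W$ for all $(\mathbb Q,w)\in\mathcal W$ and $\lambda\in L^\infty(\mathcal F_t)_{++}$. **Statement.** Let $R_t:L^p_d(\mathcal F_T)\to\mathcal G(M_t;(M_t)_+)$ be a function. 1. $R_t$ is a closed conditionally convex conditional risk measure if and only if there is a penalty function $-\alpha_t$ satisfying (1) and (2). In this case the minimal penalty function $-\alpha_t^{\min}(\mathbb Q,w)=\operatorname{cl}\bigcup_{Z\in A_{R_t}}\tilde F_{(\mathbb Q,w)}[Z]$ is a penalty function satisfying (1) and (2). 2. $R_t$ is a closed conditionally coherent conditional risk measure if and only if there is a nonempty set $\mathcal W\subseteq\mathcal W^q_t$, conditionally conical in the second variable, satisfying (3). In this case the maximal dual set $$\mathcal W^{\max}=\{(\mathbb Q,w)\in\mathcal W^q_t:\ \mathbb E[(\operatorname{diag}(w)\,\xi^{\mathbb Q}_{t,T})^{\mathsf T}X]\ge0\ \ \forall X\in A_{R_t}\}$$ is such a set; moreover $(\mathbb Q,\lambda w)\in\mathcal W^{\max}$ for all $(\mathbb Q,w)\in\mathcal W^{\max}$ and every $\lambda\in L^\infty(\mathcal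 F_t)$ that is merely a.s. strictly positive. -/

import Mathlib

open MeasureTheory
open scoped ENNReal Pointwise

noncomputable section

namespace SetRisk

/-- `L^p_d(Ω, 𝓕_T, P)`; the ambient σ-algebra of `Ω` plays the role of `𝓕_T`.  The norm of `ℝ^d` is
irrelevant (all norms are equivalent), so `Fin d → ℝ` is used. -/
abbrev RV {Ω : Type*} [MeasurableSpace Ω] (d : ℕ) (p : ℝ≥0∞) (P : Measure Ω) : Type _ :=
  Lp (Fin d → ℝ) p P

section Basic

variable {Ω : Type*} (𝓕t : MeasurableSpace Ω) [MeasurableSpace Ω] {d : ℕ}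

/-- `E[Xᵀ Y]`. -/
def pairing (P : Measure Ω) (X Y : Ω → Fin d → ℝ) : ℝ := ∫ ω, X ω ⬝ᵥ Y ω ∂P

open Classical in
/-- The norm topology of `L^p_d(𝓕_T)` if `p < ∞`, the weak* topology `σ(L^∞, L^1)` if `p = ∞`. -/
@[reducible]
def topo (d : ℕ) (p : ℝ≥0∞) [Fact (1 ≤ p)] (P : Measure Ω) : TopologicalSpace (RV d p P) :=
  if p = ∞ then
    TopologicalSpace.induced (fun (X : RV d p P) (Y : RV d 1 P) => pairing P X Y)
      Pi.topologicalSpace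
  else inferInstance

/-- Closure with respect to `topo`. -/
def cl {p : ℝ≥0∞} [Fact (1 ≤ p)] {P : Measure Ω} (S : Set (RV d p P)) : Set (RV d p P) :=
  @closure _ (topo d p P) S

/-- The nonnegative cone `L^p_d(𝓕_T)_+`. -/
def posCone (d : ℕ) (p : ℝ≥0∞) (P : Measure Ω) : Set (RV d p P) :=
  {X | ∀ᵐ ω ∂P, ∀ i, 0 ≤ X ω i}

/-- `L^p_d(𝓕_t)` as a subspace of `L^p_d(𝓕_T)`. -/
def LpAt (d : ℕ) (p : ℝ≥0∞) (P : Measure Ω) : Set (RV d p P) :=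
  {X | AEStronglyMeasurable[𝓕t] X P}

/-- The eligible portfolios `M_t`: the elements of `L^p_d(𝓕_t)` with values a.s. in the random
set `Mtilde`. -/
def eligible (Mtilde : Ω → Set (Fin d → ℝ)) (p : ℝ≥0∞)
    (P : Measure Ω) : Set (RV d p P) :=
  {u | u ∈ LpAt 𝓕t d p P ∧ ∀ᵐ ω ∂P, u ω ∈ Mtilde ω}

/-- The scalar space `L^∞(𝓕_t)`. -/
def LInf (P : Measure Ω) : Set (Lp ℝ ∞ P) :=
  {l | AEStronglyMeasurable[𝓕t] l P}

/-- The uniformly positive elements of `L^∞(𝓕_t)`, i.e. the interior of its nonnegative cone. -/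
def LInfPos (P : Measure Ω) : Set (Lp ℝ ∞ P) :=
  {l | l ∈ LInf 𝓕t P ∧ ∃ ε : ℝ, 0 < ε ∧ ∀ᵐ ω ∂P, ε ≤ l ω}

variable {p q : ℝ≥0∞} {P : Measure Ω}

/-- The pointwise product `l X` for `l ∈ L^∞`. -/
def lmul (l : Lp ℝ ∞ P) (X : RV d p P) : RV d p P := l • X

/-- `1 - l` for `l ∈ L^∞`. -/
def oneSub [IsFiniteMeasure P] (l : Lp ℝ ∞ P) : Lp ℝ ∞ P := Lp.const ∞ P (1 : ℝ) - l

/-- `l D = {l u : u ∈ D}`. -/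
def mulSet (l : Lp ℝ ∞ P) (D : Set (RV d p P)) : Set (RV d p P) := (fun u => lmul l u) '' D

/-- `(M_t)_+`. -/
def nonneg (M : Set (RV d p P)) : Set (RV d p P) := M ∩ posCone d p P

/-- `𝓟(M_t; (M_t)_+)`. -/
def upperSets (M : Set (RV d p P)) : Set (Set (RV d p P)) :=
  {D | D ⊆ M ∧ D = D + nonneg M}

/-- `𝓖(M_t; (M_t)_+)`. -/
def closedConvexUpperSets [Fact (1 ≤ p)] (M : Set (RV d p P)) : Set (Set (RV d p P)) :=
  {D | D ⊆ M ∧ D = cl (convexHull ℝ (D + nonneg M))}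

/-- Conditional risk measures. -/
structure IsCondRiskMeasure (M : Set (RV d p P)) (R : RV d p P → Set (RV d p P)) : Prop where
  mem_upperSets : ∀ X, R X ∈ upperSets M
  translative : ∀ X, ∀ m ∈ M, R (X + m) = (fun u => u - m) '' R X
  monotone : ∀ X Y, Y - X ∈ posCone d p P → R X ⊆ R Y
  nonempty_zero : R 0 ≠ ∅
  zero_ne : R 0 ≠ M

/-- The graph of `R` is closed (in the product of the topologies `topo`). -/
def HasClosedGraph [Fact (1 ≤ p)] (M : Set (RV d p P)) (R : RV d p P → Set (RV d p P)) : Prop :=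
  @IsClosed (RV d p P × RV d p P) (@instTopologicalSpaceProd _ _ (topo d p P) (topo d p P))
    {z | z.2 ∈ M ∧ z.2 ∈ R z.1}

def IsCondConvex [IsFiniteMeasure P] (R : RV d p P → Set (RV d p P)) :
    Prop :=
  ∀ X Y, ∀ l ∈ LInf 𝓕t P, (∀ᵐ ω ∂P, 0 ≤ l ω ∧ l ω ≤ 1) →
    mulSet l (R X) + mulSet (oneSub l) (R Y) ⊆ R (lmul l X + lmul (oneSub l) Y)

def IsCondPosHomogeneous (R : RV d p P → Set (RV d p P)) : Prop :=
  ∀ X, ∀ l ∈ LInfPos 𝓕t P, R (lmul l X) = mulSet l (R X)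

def IsSubadditive (R : RV d p P → Set (RV d p P)) : Prop :=
  ∀ X Y, R X + R Y ⊆ R (X + Y)

def IsCondCoherent [IsFiniteMeasure P] 
    (R : RV d p P → Set (RV d p P)) : Prop :=
  (IsCondConvex 𝓕t R ∧ IsCondPosHomogeneous 𝓕t R) ∨
    (IsSubadditive R ∧ IsCondPosHomogeneous 𝓕t R)

/-- The acceptance set of `R`. -/
def acceptance (R : RV d p P → Set (RV d p P)) : Set (RV d p P) := {X | 0 ∈ R X}

/-- The halfspace `G_t(w) ⊆ L^p_d(𝓕_t)`. -/
def halfspace (p : ℝ≥0∞) (w : RV d q P) : Set (RV d p P) :=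
  {x | x ∈ LpAt 𝓕t d p P ∧ 0 ≤ pairing P w x}

/-- The positive dual `((M_t)_+)^+ ⊆ L^q_d(𝓕_t)`. -/
def posDual (q : ℝ≥0∞) (M : Set (RV d p P)) : Set (RV d q P) :=
  {v | v ∈ LpAt 𝓕t d q P ∧ ∀ u ∈ nonneg M, 0 ≤ pairing P v u}

/-- The annihilator `M_t^⊥ ⊆ L^q_d(𝓕_t)`. -/
def perp (q : ℝ≥0∞) (M : Set (RV d p P)) : Set (RV d q P) :=
  {v | v ∈ LpAt 𝓕t d q P ∧ ∀ u ∈ M, pairing P v u = 0}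

end Basic

section Dual

variable {Ω : Type*} (𝓕t : MeasurableSpace Ω) [m0 : MeasurableSpace Ω] {d : ℕ}

/-- The density `dQ/dP`. -/
def density (P Q : Measure Ω) (ω : Ω) : ℝ := (Q.rnDeriv P ω).toReal

open Classical in
/-- The one-step transition density from time `s` to time `s + 1`,
`E[dQ/dP | 𝓕_{s+1}] / E[dQ/dP | 𝓕_s]`, set to `1` where the denominator is not positive. -/
def stepDensity (𝓕 : Filtration ℕ m0) (P Q : Measure Ω) (s : ℕ) (ω : Ω) : ℝ :=
  if 0 < (P[density P Q | 𝓕 s]) ω then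
    (P[density P Q | 𝓕 (s + 1)]) ω / (P[density P Q | 𝓕 s]) ω
  else 1

/-- The vector `diag(E[dQ/dP | 𝓕_t])⁻¹ dQ/dP`, understood as the product of the one-step
transition densities between `t` and `T`. -/
def transDensity (𝓕 : Filtration ℕ m0) (T t : ℕ) (P : Measure Ω) (Q : Fin d → Measure Ω)
    (ω : Ω) (i : Fin d) : ℝ :=
  ∏ s ∈ Finset.Ico t T, stepDensity 𝓕 P (Q i) s ω

/-- The generalized conditional expectation `E[Z⁺ | 𝓕_t] - E[Z⁻ | 𝓕_t]`.  It is the usual one if `Z`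
is integrable, and it is the correct one at every `ω` where `E[|Z| | 𝓕_t]` is finite. -/
def genCondExp (P : Measure Ω) (Z : Ω → ℝ) (ω : Ω) : ℝ :=
  (condLExp 𝓕t P (fun η => ENNReal.ofReal (Z η)) ω).toReal -
    (condLExp 𝓕t P (fun η => ENNReal.ofReal (-Z η)) ω).toReal

/-- The `P`-almost sure version of the `Q`-conditional expectation,
`E^Q_t[X] = E[diag(transDensity) X | 𝓕_t]`. -/
def qCondExp (𝓕 : Filtration ℕ m0) (T t : ℕ) (P : Measure Ω) (Q : Fin d → Measure Ω)
    (X : Ω → Fin d → ℝ) (ω : Ω) (i : Fin d) : ℝ :=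
  genCondExp (𝓕 t) P (fun η => transDensity 𝓕 T t P Q η i * X η i) ω

variable {p q : ℝ≥0∞} {P : Measure Ω}

/-- `diag(w) diag(E[dQ/dP | 𝓕_t])⁻¹ dQ/dP`. -/
def dualDensity (𝓕 : Filtration ℕ m0) (T t : ℕ) (Q : Fin d → Measure Ω) (w : RV d q P)
    (ω : Ω) (i : Fin d) : ℝ :=
  w ω i * transDensity 𝓕 T t P Q ω i

/-- The set `𝓦_t^q` of dual variables. -/
def dualVars (𝓕 : Filtration ℕ m0) (T t : ℕ) (q : ℝ≥0∞) (M : Set (RV d p P)) :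
    Set ((Fin d → Measure Ω) × RV d q P) :=
  {z | (∀ i, IsProbabilityMeasure (z.1 i) ∧ z.1 i ≪ P) ∧
    z.2 ∈ posDual (𝓕 t) q M \ perp (𝓕 t) q M ∧
    MemLp (dualDensity 𝓕 T t z.1 z.2) q P ∧
    ∀ᵐ ω ∂P, ∀ i, 0 ≤ dualDensity 𝓕 T t z.1 z.2 ω i}

/-- The set-valued functional `(E^Q_t[X] + G_t(w)) ∩ M_t`, i.e.
`{u ∈ M_t : E[wᵀ E^Q_t[X]] ≤ E[wᵀ u]}`. -/
def dualFun (𝓕 : Filtration ℕ m0) (T t : ℕ) (M : Set (RV d p P))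
    (z : (Fin d → Measure Ω) × RV d q P) (X : RV d p P) : Set (RV d p P) :=
  {u | u ∈ M ∧ pairing P z.2 (qCondExp 𝓕 T t P z.1 X) ≤ pairing P z.2 u}

/-- `a` (in the literature often written `-α_t`) is a penalty function at time `t`; only its values on `𝓦_t^q`
matter. -/
structure IsPenalty [Fact (1 ≤ p)] (𝓕 : Filtration ℕ m0) (T t : ℕ) (M : Set (RV d p P))
    (a : (Fin d → Measure Ω) × RV d q P → Set (RV d p P)) : Prop where
  mem : ∀ z ∈ dualVars 𝓕 T t q M, a z ∈ closedConvexUpperSets M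
  nonempty_iInter : (⋂ z ∈ dualVars 𝓕 T t q M, a z).Nonempty
  exists_ne : ∃ z ∈ dualVars 𝓕 T t q M, a z ≠ M
  eq_cl : ∀ z ∈ dualVars 𝓕 T t q M, a z = cl (a z + halfspace (𝓕 t) p z.2) ∩ M

/-- `a(Q, w) ⊇ l a(Q, l w) + (1 - l) a(Q, (1 - l) w)` for all `l ∈ L^∞(𝓕_t)` with `0 < l < 1`. -/
def IsCondPenalty [IsFiniteMeasure P] (𝓕 : Filtration ℕ m0) (T t : ℕ) (M : Set (RV d p P))
    (a : (Fin d → Measure Ω) × RV d q P → Set (RV d p P)) : Prop :=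
  ∀ z ∈ dualVars 𝓕 T t q M, ∀ l ∈ LInf (𝓕 t) P, (∀ᵐ ω ∂P, 0 < l ω ∧ l ω < 1) →
    mulSet l (a (z.1, lmul l z.2)) + mulSet (oneSub l) (a (z.1, lmul (oneSub l) z.2)) ⊆ a z

/-- The dual representation of `R` by the penalty function `a`. -/
def ConvexDualRep (𝓕 : Filtration ℕ m0) (T t : ℕ) (M : Set (RV d p P))
    (R : RV d p P → Set (RV d p P))
    (a : (Fin d → Measure Ω) × RV d q P → Set (RV d p P)) : Prop :=
  ∀ X, R X = ⋂ z ∈ dualVars 𝓕 T t q M, (a z + dualFun 𝓕 T t M z (-X))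

/-- The minimal penalty function of `R`. -/
def minPenalty [Fact (1 ≤ p)] (𝓕 : Filtration ℕ m0) (T t : ℕ) (M : Set (RV d p P))
    (R : RV d p P → Set (RV d p P)) (z : (Fin d → Measure Ω) × RV d q P) : Set (RV d p P) :=
  cl (⋃ Z ∈ acceptance R, dualFun 𝓕 T t M z Z)

/-- The dual representation of `R` by the set `W` of dual variables. -/
def CoherentDualRep (𝓕 : Filtration ℕ m0) (T t : ℕ) (M : Set (RV d p P))
    (R : RV d p P → Set (RV d p P)) (W : Set ((Fin d → Measure Ω) × RV d q P)) : Prop :=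
  ∀ X, R X = ⋂ z ∈ W, dualFun 𝓕 T t M z (-X)

/-- `W` is conditionally conical in the second variable. -/
def IsCondConical (W : Set ((Fin d → Measure Ω) × RV d q P)) : Prop :=
  ∀ z ∈ W, ∀ l ∈ LInfPos 𝓕t P, (z.1, lmul l z.2) ∈ W

/-- The maximal dual set of `R`. -/
def maxDualSet (𝓕 : Filtration ℕ m0) (T t : ℕ) (q : ℝ≥0∞) (M : Set (RV d p P))
    (R : RV d p P → Set (RV d p P)) : Set ((Fin d → Measure Ω) × RV d q P) :=
  {z | z ∈ dualVars 𝓕 T t q M ∧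
    ∀ X ∈ acceptance R, 0 ≤ pairing P (dualDensity 𝓕 T t z.1 z.2) X}

end Dual

end SetRisk

end

/-! Translativity reduces `R` to its acceptance set `A`: a portfolio `u ∈ M` lies in `R X` exactly
when `X + u ∈ A` (`IsCondRiskMeasure.mem_iff`). For a closed, convex or coherent risk measure, `A`
is a closed convex set stable under adding nonnegative vectors, so the theorem becomes a statement
about half-spaces containing `A`.

A dual pair `(Q, w)` is a way of writing a nonnegative functional on `L^p_d(𝓕_T)`. With `Y = diag(w)
ξ`, the identity `E[ξ_i | 𝓕_t] = 1` gives `E[Yᵀu] = E[wᵀu]` for `𝓕_t`-measurable `u`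
(`pairing_dualVec_of_mem_LpAt`), and `E[wᵀ E^Q_t X] = E[YᵀX]` for all `X` (`pairing_qCondExp`).
Conversely, every nonnegative `Y ∈ L^q_d` that does not vanish on `M` arises in this way, with `w =
E[Y | 𝓕_t]` (`exists_dualVar`). Hence `dualFun` is a half-space of `M`, and a penalty value is a
subset of `M` cut out by a lower bound on one functional (`boundSet`, `minPenalty_eq`,
`penalty_eq_boundSet`).

Existence of enough dual pairs is Hahn-Banach. The dual of the chosen topology is `L^q_d`, by Riesz
representation for `p < ∞` and by the choice of the weak* topology for `p = ∞`
(`exists_separating`). Monotonicity of `A` makes a separating functional nonnegative, and a small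
perturbation makes it nonzero on `M` (`exists_dualVar_separating`).

The conditional statements use that the functional of `(Q, λw)` at `X` is the functional of `(Q, w)`
at `λX` (`dualEval_lmul`). This turns property (1) into conditional convexity, with weights touching
0 or 1 reached by approximation. In the coherent case `A` is a cone, the bounds become 0, and
conical dual sets correspond to conditional positive homogeneity. -/

noncomputable section

namespace SetRisk

/-! ### The pairing of `L^q_d` with `L^p_d` and multiplication by scalars in `L^∞`. -/

section Pairing

variable {Ω : Type*} [m0 : MeasurableSpace Ω] {d : ℕ} {p q : ℝ≥0∞} {P : Measure Ω}

/-- The dot product as a continuous bilinear form. -/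
def dotCLM (d : ℕ) : (Fin d → ℝ) →L[ℝ] (Fin d → ℝ) →L[ℝ] ℝ :=
  ∑ i, (ContinuousLinearMap.proj (R := ℝ) (φ := fun _ : Fin d => ℝ) i).smulRight
    (ContinuousLinearMap.proj (R := ℝ) (φ := fun _ : Fin d => ℝ) i)

lemma dotCLM_apply (x y : Fin d → ℝ) : dotCLM d x y = x ⬝ᵥ y := by
  simp [dotCLM, dotProduct]

/-- The pairing of `L^q_d` and `L^p_d` as a continuous bilinear form. -/
def pair (d : ℕ) (p q : ℝ≥0∞) (P : Measure Ω) [Fact (1 ≤ p)] [Fact (1 ≤ q)]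
    [h : ENNReal.HolderConjugate p q] : RV d q P →L[ℝ] RV d p P →L[ℝ] ℝ :=
  have : ENNReal.HolderConjugate q p := h.symm
  ContinuousLinearMap.lpPairing P q p (dotCLM d)

lemma pair_apply [Fact (1 ≤ p)] [Fact (1 ≤ q)] [h : ENNReal.HolderConjugate p q]
    (y : RV d q P) (x : RV d p P) : pair d p q P y x = pairing P y x := by
  have : ENNReal.HolderConjugate q p := h.symm
  rw [pair, ContinuousLinearMap.lpPairing_eq_integral]
  simp [pairing, dotCLM_apply]

lemma pairing_congr {f f' g g' : Ω → Fin d → ℝ} (hf : f =ᵐ[P] f') (hg : g =ᵐ[P] g') :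
    pairing P f g = pairing P f' g' :=
  integral_congr_ae (by filter_upwards [hf, hg] with ω h1 h2; rw [h1, h2])

lemma pairing_comm (f g : Ω → Fin d → ℝ) : pairing P f g = pairing P g f := by
  simp only [pairing, dotProduct_comm]

lemma lmul_coe (l : Lp ℝ ∞ P) (X : RV d p P) : ⇑(lmul l X) =ᵐ[P] fun ω => l ω • X ω :=
  Lp.coeFn_lpSMul l X

lemma lmul_const [IsFiniteMeasure P] (c : ℝ) (X : RV d p P) :
    lmul (Lp.const ∞ P c) X = c • X := by
  refine Lp.ext ?_
  filter_upwards [lmul_coe (Lp.const ∞ P c) X, Lp.coeFn_const (p := ∞) (μ := P) c,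
    Lp.coeFn_smul c X] with ω h1 h2 h3
  rw [h1, h2, h3]; rfl

lemma oneSub_coe [IsFiniteMeasure P] (l : Lp ℝ ∞ P) : ⇑(oneSub l) =ᵐ[P] fun ω => 1 - l ω := by
  filter_upwards [Lp.coeFn_sub (Lp.const ∞ P (1 : ℝ)) l,
    Lp.coeFn_const (p := ∞) (μ := P) (1 : ℝ)] with ω h1 h2
  rw [oneSub, h1, Pi.sub_apply, h2]; rfl

lemma lmul_add (l : Lp ℝ ∞ P) (X Y : RV d p P) : lmul l (X + Y) = lmul l X + lmul l Y :=
  Lp.add_smul _ _ _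

lemma lmul_neg (l : Lp ℝ ∞ P) (X : RV d p P) : lmul l (-X) = -lmul l X :=
  Lp.smul_neg l X

lemma add_lmul (l l' : Lp ℝ ∞ P) (X : RV d p P) : lmul (l + l') X = lmul l X + lmul l' X :=
  Lp.smul_add _ _ _

lemma oneSub_lmul [IsFiniteMeasure P] (l : Lp ℝ ∞ P) (X : RV d p P) :
    lmul (oneSub l) X = X - lmul l X := by
  refine Lp.ext ?_
  filter_upwards [lmul_coe (oneSub l) X, oneSub_coe l, lmul_coe l X,
    Lp.coeFn_sub X (lmul l X)] with ω h1 h2 h3 h4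
  rw [h1, h2, h4, Pi.sub_apply, h3, sub_smul, one_smul]

lemma smul_lmul (c : ℝ) (l : Lp ℝ ∞ P) (X : RV d p P) : lmul (c • l) X = c • lmul l X := by
  refine Lp.ext ?_
  filter_upwards [lmul_coe (c • l) X, Lp.coeFn_smul c l, lmul_coe l X,
    Lp.coeFn_smul c (lmul l X)] with ω h1 h2 h3 h4
  rw [h1, h2, h4, Pi.smul_apply, Pi.smul_apply, h3, smul_assoc]

lemma pairing_lmul (l : Lp ℝ ∞ P) (y : RV d q P) (x : RV d p P) :
    pairing P (lmul l y) x = pairing P y (lmul l x) := by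
  refine integral_congr_ae ?_
  filter_upwards [lmul_coe l y, lmul_coe l x] with ω h1 h2
  rw [h1, h2, smul_dotProduct, dotProduct_smul]

lemma integrable_dotProduct [h : ENNReal.HolderConjugate p q] {f g : Ω → Fin d → ℝ}
    (hf : MemLp f q P) (hg : MemLp g p P) (i : Fin d) :
    Integrable (fun ω => f ω i * g ω i) P := by
  have : ENNReal.HolderConjugate q p := h.symm
  exact (memLp_pi_iff.1 hf i).integrable_mul (memLp_pi_iff.1 hg i)

lemma pairing_eq_sum [h : ENNReal.HolderConjugate p q] {f g : Ω → Fin d → ℝ}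
    (hf : MemLp f q P) (hg : MemLp g p P) :
    pairing P f g = ∑ i, ∫ ω, f ω i * g ω i ∂P := by
  rw [pairing]
  simp only [dotProduct]
  exact integral_finsetSum _ fun i _ => integrable_dotProduct hf hg i

end Pairing

/-! ### Riesz representation of the dual of `L^p_d` for `p < ∞`. -/

section Riesz

variable {Ω : Type*} [m0 : MeasurableSpace Ω] {d : ℕ} {p q : ℝ≥0∞} {P : Measure Ω}
  [IsFiniteMeasure P]

lemma sum_indicatorConstLp {f : ℕ → Set Ω} (hf : ∀ i, MeasurableSet (f i))
    (hd : Pairwise (Function.onFun Disjoint f)) (s : Finset ℕ) :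
    ∑ i ∈ s, indicatorConstLp p (hf i) (measure_ne_top P _) (1 : ℝ) =
      indicatorConstLp p (Finset.measurableSet_biUnion s fun i _ => hf i)
        (measure_ne_top P (⋃ i ∈ s, f i)) (1 : ℝ) := by
  classical
  induction s using Finset.induction_on with
  | empty => 
    rw [Finset.sum_empty]
    refine Lp.ext ?_
    filter_upwards [Lp.coeFn_zero ℝ p P, indicatorConstLp_coeFn (p := p) (c := (1 : ℝ))
      (hs := Finset.measurableSet_biUnion (∅ : Finset ℕ) fun i _ => hf i)
      (hμs := measure_ne_top P (⋃ i ∈ (∅ : Finset ℕ), f i))] with ω h1 h2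
    rw [h1, h2]; simp
  | insert a s ha ih =>
    rw [Finset.sum_insert ha, ih]
    refine Lp.ext ?_
    have hdisj : Disjoint (f a) (⋃ i ∈ s, f i) := by
      simp only [Set.disjoint_iUnion_right]
      exact fun i hi => hd (fun h => ha (h ▸ hi))
    filter_upwards [Lp.coeFn_add (indicatorConstLp p (hf a) (measure_ne_top P _) (1 : ℝ))
      (indicatorConstLp p (Finset.measurableSet_biUnion s fun i _ => hf i)
        (measure_ne_top P (⋃ i ∈ s, f i)) (1 : ℝ)),
      indicatorConstLp_coeFn (p := p) (c := (1 : ℝ)) (hs := hf a) (hμs := measure_ne_top P _),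
      indicatorConstLp_coeFn (p := p) (c := (1 : ℝ))
        (hs := Finset.measurableSet_biUnion s fun i _ => hf i)
        (hμs := measure_ne_top P (⋃ i ∈ s, f i)),
      indicatorConstLp_coeFn (p := p) (c := (1 : ℝ))
        (hs := Finset.measurableSet_biUnion (insert a s) fun i _ => hf i)
        (hμs := measure_ne_top P (⋃ i ∈ insert a s, f i))] with ω h1 h2 h3 h4
    rw [h1, h4, Pi.add_apply, h2, h3, Finset.set_biUnion_insert,
      Set.indicator_union_of_disjoint hdisj]

/-- Supplies countable additivity of `A ↦ φ(1_A)`. The symmetric differences of the finite unions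
with the full union decrease to the empty set, so their measures tend to 0; for `p < ∞` this gives
convergence of indicators in `L^p`. -/
lemma hasSum_indicatorConstLp [Fact (1 ≤ p)] (hp : p ≠ ∞) {f : ℕ → Set Ω}
    (hf : ∀ i, MeasurableSet (f i)) (hd : Pairwise (Function.onFun Disjoint f)) :
    HasSum (fun i => indicatorConstLp p (hf i) (measure_ne_top P _) (1 : ℝ))
      (indicatorConstLp p (MeasurableSet.iUnion hf) (measure_ne_top P _) (1 : ℝ)) := by
  rw [HasSum]
  simp only [SummationFilter.unconditional_filter]
  simp_rw [sum_indicatorConstLp hf hd]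
  refine tendsto_indicatorConstLp_set hp ?_
  have h := tendsto_measure_iInter_atTop (μ := P)
    (s := fun s : Finset ℕ => symmDiff (⋃ i ∈ s, f i) (⋃ i, f i))
    (fun s => ((Finset.measurableSet_biUnion s fun i _ => hf i).symmDiff
      (MeasurableSet.iUnion hf)).nullMeasurableSet) ?_ ⟨∅, measure_ne_top _ _⟩
  · refine (measure_empty (μ := P)) ▸ (?_ : _ = (∅ : Set Ω)) ▸ h
    ext ω
    simp only [Set.mem_iInter, Set.mem_symmDiff, Set.mem_iUnion, Set.mem_empty_iff_false, iff_false,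
      not_forall]
    by_cases h : ∃ i, ω ∈ f i
    · obtain ⟨i, hi⟩ := h
      refine ⟨{i}, ?_⟩
      rintro (⟨_, h⟩ | ⟨_, h⟩)
      · exact h ⟨i, hi⟩
      · exact h ⟨i, by simp, hi⟩
    · refine ⟨∅, ?_⟩
      rintro (⟨h1, _⟩ | ⟨h1, _⟩)
      · simp at h1
      · exact h h1
  · intro s t hst ω hω
    simp only [Set.mem_symmDiff, Set.mem_iUnion] at hω ⊢
    rcases hω with ⟨⟨i, _, hi⟩, h⟩ | ⟨h, h'⟩
    · exact absurd ⟨i, hi⟩ h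
    · exact Or.inr ⟨h, fun ⟨i, his, hi⟩ => h' ⟨i, hst his, hi⟩⟩

open Classical in
/-- The signed measure `A ↦ φ(1_A)` of a continuous functional on `L^p`, `p < ∞`. -/
def functionalMeasure [Fact (1 ≤ p)] (hp : p ≠ ∞) (φ : Lp ℝ p P →L[ℝ] ℝ) : SignedMeasure Ω where
  measureOf' A := if hA : MeasurableSet A then
    φ (indicatorConstLp p hA (measure_ne_top P A) (1 : ℝ)) else 0
  empty' := by
    rw [dif_pos MeasurableSet.empty]
    simp
  not_measurable' A hA := dif_neg hA
  m_iUnion' f hf hd := by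
    simp only [dif_pos (hf _), dif_pos (MeasurableSet.iUnion hf)]
    exact φ.hasSum (hasSum_indicatorConstLp hp hf hd)

lemma functionalMeasure_apply [Fact (1 ≤ p)] (hp : p ≠ ∞) (φ : Lp ℝ p P →L[ℝ] ℝ) {A : Set Ω}
    (hA : MeasurableSet A) : functionalMeasure hp φ A =
      φ (indicatorConstLp p hA (measure_ne_top P A) (1 : ℝ)) :=
  dif_pos hA

lemma exists_density [Fact (1 ≤ p)] (hp : p ≠ ∞) (φ : Lp ℝ p P →L[ℝ] ℝ) :
    ∃ g : Ω → ℝ, Measurable g ∧ Integrable g P ∧ ∀ A (hA : MeasurableSet A),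
      φ (indicatorConstLp p hA (measure_ne_top P A) (1 : ℝ)) = ∫ ω in A, g ω ∂P := by
  set ν := functionalMeasure hp φ
  refine ⟨ν.rnDeriv P, SignedMeasure.measurable_rnDeriv _ _, SignedMeasure.integrable_rnDeriv _ _,
    fun A hA => ?_⟩
  have hac : ν ≪ᵥ P.toENNRealVectorMeasure := by
    refine VectorMeasure.AbsolutelyContinuous.mk fun A hA h0 => ?_
    rw [Measure.toENNRealVectorMeasure_apply_measurable hA] at h0
    rw [functionalMeasure_apply hp φ hA]
    have : indicatorConstLp p hA (measure_ne_top P A) (1 : ℝ) = 0 := by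
      rw [← norm_eq_zero, norm_indicatorConstLp (one_pos.trans_le Fact.out).ne' hp]
      have hpos : 0 < p.toReal := ENNReal.toReal_pos (one_pos.trans_le Fact.out).ne' hp
      simp [Measure.real, h0, Real.zero_rpow (inv_ne_zero hpos.ne')]
    rw [this, map_zero]
  have h := SignedMeasure.withDensityᵥ_rnDeriv_eq ν P hac
  rw [← functionalMeasure_apply hp φ hA]
  conv_lhs => rw [show functionalMeasure hp φ = _ from h.symm]
  exact withDensityᵥ_apply (SignedMeasure.integrable_rnDeriv _ _) hA

end Riesz

section Riesz

variable {Ω : Type*} [m0 : MeasurableSpace Ω] {d : ℕ} {p q : ℝ≥0∞} {P : Measure Ω}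
  [IsFiniteMeasure P]

lemma memLp_of_abs_le {g : Ω → ℝ} (hg : Measurable g) {B : ℝ} (hB : ∀ ω, |g ω| ≤ B) :
    MemLp g p P :=
  MemLp.of_bound hg.aestronglyMeasurable B (Filter.Eventually.of_forall hB)

/-- Testing against the sign of `g` on `A = {|g| > C + 1}` gives `(C + 1) P(A) ≤ C P(A)`, so `A` is
null. The extra 1 makes this immediate, and only finiteness of the bound matters later. -/
lemma eLpNorm_top_le_of_integral_le {g : Ω → ℝ} (hg : Measurable g)
    {C : ℝ} (hC : 0 ≤ C)
    (h : ∀ f : Ω → ℝ, MemLp f 1 P → ∫ ω, g ω * f ω ∂P ≤ C * (eLpNorm f 1 P).toReal)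
    {B : ℝ} (hB : ∀ ω, |g ω| ≤ B) : eLpNorm g ∞ P ≤ ENNReal.ofReal (C + 1) := by
  rw [eLpNorm_exponent_top]
  refine eLpNormEssSup_le_of_ae_bound ?_
  set A := {ω | C + 1 < |g ω|} with hA
  have hAm : MeasurableSet A := measurableSet_lt measurable_const hg.abs
  suffices h0 : P A = 0 by
    have := measure_eq_zero_iff_ae_notMem.1 h0
    filter_upwards [this] with ω hω
    simpa [hA] using hω
  set f : Ω → ℝ := A.indicator fun ω => if 0 ≤ g ω then (1 : ℝ) else -1 with hf
  have hfm : Measurable f :=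
    (Measurable.ite (measurableSet_le measurable_const hg) measurable_const
      measurable_const).indicator hAm
  have hfb : ∀ ω, |f ω| ≤ A.indicator (fun _ => (1 : ℝ)) ω := by
    intro ω
    by_cases hω : ω ∈ A
    · rw [hf, Set.indicator_of_mem hω, Set.indicator_of_mem hω]
      split_ifs <;> simp
    · simp [hf, hω]
  have h1 := h f (memLp_of_abs_le hfm fun ω => (hfb ω).trans
    (Set.indicator_le_self' (fun _ _ => zero_le_one) ω))
  have e1 : ∫ ω, g ω * f ω ∂P = ∫ ω in A, |g ω| ∂P := by
    rw [← integral_indicator hAm]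
    refine integral_congr_ae (Filter.Eventually.of_forall fun ω => ?_)
    by_cases hωA : ω ∈ A
    · simp only [hf, Set.indicator_of_mem hωA]
      split_ifs with h0
      · rw [abs_of_nonneg h0, mul_one]
      · rw [abs_of_neg (not_le.1 h0), mul_neg_one]
    · simp [hf, hωA]
  have e2 : (eLpNorm f 1 P).toReal ≤ P.real A := by
    have : eLpNorm f 1 P ≤ P A := by
      refine (eLpNorm_mono_real (g := A.indicator fun _ => (1 : ℝ)) hfb).trans ?_
      rw [eLpNorm_indicator_const hAm one_ne_zero ENNReal.one_ne_top]
      simp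
    exact ENNReal.toReal_mono (measure_ne_top _ _) this
  have e3 : (C + 1) * P.real A ≤ ∫ ω in A, |g ω| ∂P :=
    setIntegral_ge_of_const_le_real hAm (measure_ne_top P A) (fun ω hω => le_of_lt hω)
      ((memLp_of_abs_le (p := 1) hg hB).integrable le_rfl).abs.integrableOn
  have e4 : P.real A ≤ 0 := by
    have := mul_le_mul_of_nonneg_left e2 hC
    linarith
  exact (measureReal_eq_zero_iff).1 (le_antisymm e4 measureReal_nonneg)

lemma eLpNorm_le_of_integral_le_of_ne_top [hpq : ENNReal.HolderConjugate p q]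
    (hp : p ≠ ∞) (hq : q ≠ ∞) {g : Ω → ℝ} (hg : Measurable g) {C : ℝ} (hC : 0 ≤ C)
    (h : ∀ f : Ω → ℝ, MemLp f p P → ∫ ω, g ω * f ω ∂P ≤ C * (eLpNorm f p P).toReal)
    {B : ℝ} (hB : ∀ ω, |g ω| ≤ B) : eLpNorm g q P ≤ ENNReal.ofReal C := by
  have hconj := ENNReal.HolderConjugate.toReal_of_ne_top hp hq
  set s := p.toReal
  set r := q.toReal
  have hs : 0 < s := hconj.pos
  have hr : 0 < r := hconj.symm.pos
  have hr1 : 0 < r - 1 := hconj.symm.sub_one_pos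
  have hp0 : p ≠ 0 := fun h => by simp [s, h] at hs
  have hq0 : q ≠ 0 := fun h => by simp [r, h] at hr
  -- The extremal function in Hölder's inequality: `g f = |g|^r` and `|f|^s = |g|^r`, where `s` and
  -- `r` are the real exponents of `p` and `q`.
  set f : Ω → ℝ := fun ω => (if 0 ≤ g ω then (1 : ℝ) else -1) * |g ω| ^ (r - 1) with hf
  have hfm : Measurable f :=
    (Measurable.ite (measurableSet_le measurable_const hg) measurable_const
      measurable_const).mul (hg.abs.pow_const _)
  have hfabs : ∀ ω, |f ω| = |g ω| ^ (r - 1) := by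
    intro ω
    simp only [hf, abs_mul, abs_of_nonneg (Real.rpow_nonneg (abs_nonneg (g ω)) _)]
    split_ifs <;> simp
  have hfL : MemLp f p P := memLp_of_abs_le hfm fun ω => by
    rw [hfabs]
    exact Real.rpow_le_rpow (abs_nonneg _) (hB ω) hr1.le
  have hgL : MemLp g q P := memLp_of_abs_le hg hB
  have h1 := h f hfL
  set I := ∫ ω, |g ω| ^ r ∂P with hI
  have hI0 : 0 ≤ I := integral_nonneg fun ω => Real.rpow_nonneg (abs_nonneg _) _
  have e1 : ∫ ω, g ω * f ω ∂P = I := by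
    refine integral_congr_ae (Filter.Eventually.of_forall fun ω => ?_)
    have : g ω * f ω = |g ω| * |g ω| ^ (r - 1) := by
      simp only [hf]
      split_ifs with h0
      · rw [abs_of_nonneg h0, one_mul]
      · rw [abs_of_neg (not_le.1 h0)]; ring
    simp only [this]
    nth_rewrite 1 [← Real.rpow_one |g ω|]
    rw [← Real.rpow_add_of_nonneg (abs_nonneg _) zero_le_one hr1.le]
    congr 1; ring
  have e2 : (eLpNorm f p P).toReal = I ^ s⁻¹ := by
    rw [hfL.eLpNorm_eq_integral_rpow_norm hp0 hp, ENNReal.toReal_ofReal (by positivity), hI]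
    congr 1
    refine integral_congr_ae (Filter.Eventually.of_forall fun ω => ?_)
    simp only [Real.norm_eq_abs]
    rw [hfabs, ← Real.rpow_mul (abs_nonneg _), hconj.symm.sub_one_mul_conj]
  rw [hgL.eLpNorm_eq_integral_rpow_norm hq0 hq]
  refine ENNReal.ofReal_le_ofReal ?_
  simp only [Real.norm_eq_abs]
  change I ^ r⁻¹ ≤ C
  rw [e1, e2] at h1
  rcases hI0.eq_or_lt with h0 | h0
  · rw [← h0, Real.zero_rpow (inv_ne_zero hr.ne')]
    exact hC
  · have h2 : I ^ r⁻¹ * I ^ s⁻¹ = I := by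
      rw [← Real.rpow_add h0, add_comm, hconj.inv_add_inv_eq_one, Real.rpow_one]
    have h3 : 0 < I ^ s⁻¹ := Real.rpow_pos_of_pos h0 _
    refine le_of_mul_le_mul_right ?_ h3
    rwa [h2]

lemma eLpNorm_le_of_integral_le [hpq : ENNReal.HolderConjugate p q]
    (hp : p ≠ ∞) {g : Ω → ℝ} (hg : Measurable g) {C : ℝ} (hC : 0 ≤ C)
    (h : ∀ f : Ω → ℝ, MemLp f p P → ∫ ω, g ω * f ω ∂P ≤ C * (eLpNorm f p P).toReal)
    {B : ℝ} (hB : ∀ ω, |g ω| ≤ B) : eLpNorm g q P ≤ ENNReal.ofReal (C + 1) := by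
  have hqp : ENNReal.HolderConjugate q p := hpq.symm
  by_cases hq : q = ∞
  · have hp1 : p = 1 := (ENNReal.HolderConjugate.eq_top_iff_eq_one q p).1 hq
    subst hq hp1
    exact eLpNorm_top_le_of_integral_le hg hC h hB
  · exact (eLpNorm_le_of_integral_le_of_ne_top hp hq hg hC h hB).trans
      (ENNReal.ofReal_le_ofReal (by linarith))

/-- The density `g` of the signed measure `A ↦ φ(1_A)` is at first only integrable. Its truncations
represent `φ` composed with multiplication by an indicator, so their `L^q` norms are bounded by `‖φ‖
+ 1`, and Fatou passes the bound to `g`. -/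
lemma exists_memLp_density [Fact (1 ≤ p)] [Fact (1 ≤ q)] [hpq : ENNReal.HolderConjugate p q]
    (hp : p ≠ ∞) (φ : Lp ℝ p P →L[ℝ] ℝ) :
    ∃ g : Lp ℝ q P, ∀ f : Lp ℝ p P, φ f = ∫ ω, g ω * f ω ∂P := by
  have hqp : ENNReal.HolderConjugate q p := hpq.symm
  obtain ⟨g, hgm, hgi, hg⟩ := exists_density hp φ
  -- Applied twice: to the sets where `g` is bounded, to obtain `g ∈ L^q`, and then to the whole
  -- space, to obtain the representation. Both sides are continuous in `f`, so indicators suffice.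
  have key : ∀ (e : Lp ℝ ∞ P) (E : Set Ω) (hE : MeasurableSet E),
      (e =ᵐ[P] E.indicator fun _ => (1 : ℝ)) → ∀ G : Lp ℝ q P, (G =ᵐ[P] E.indicator g) →
      ∀ f : Lp ℝ p P, φ ((ContinuousLinearMap.mul ℝ ℝ).holderL P ∞ p p e f) =
        ContinuousLinearMap.lpPairing P q p (ContinuousLinearMap.mul ℝ ℝ) G f := by
    intro e E hE he G hG f
    refine Lp.induction hp (fun f => φ ((ContinuousLinearMap.mul ℝ ℝ).holderL P ∞ p p e f) =
        ContinuousLinearMap.lpPairing P q p (ContinuousLinearMap.mul ℝ ℝ) G f) ?_ ?_ ?_ f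
    · intro c A hA hPA
      rw [Lp.simpleFunc.coe_indicatorConst]
      have h1 : (ContinuousLinearMap.mul ℝ ℝ).holderL P ∞ p p e (indicatorConstLp p hA hPA.ne c) =
          c • indicatorConstLp p (hA.inter hE) (measure_ne_top P _) (1 : ℝ) := by
        refine Lp.ext ?_
        filter_upwards [ContinuousLinearMap.coeFn_holder (r := p) (ContinuousLinearMap.mul ℝ ℝ) e
          (indicatorConstLp p hA hPA.ne c), he,
          indicatorConstLp_coeFn (p := p) (c := c) (hs := hA) (hμs := hPA.ne),
          indicatorConstLp_coeFn (p := p) (c := (1 : ℝ)) (hs := hA.inter hE)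
            (hμs := measure_ne_top P _),
          Lp.coeFn_smul c (indicatorConstLp p (hA.inter hE) (measure_ne_top P _) (1 : ℝ))]
          with ω h1 h2 h3 h4 h5
        rw [h5, Pi.smul_apply, h4]
        refine h1.trans ?_
        rw [h2, h3]
        by_cases hωA : ω ∈ A <;> by_cases hωE : ω ∈ E <;> simp [hωA, hωE]
      rw [h1, map_smul, hg _ (hA.inter hE), ContinuousLinearMap.lpPairing_eq_integral, smul_eq_mul,
        ← integral_indicator (hA.inter hE), ← integral_const_mul]
      refine integral_congr_ae ?_
      filter_upwards [hG, indicatorConstLp_coeFn (p := p) (c := c) (hs := hA) (hμs := hPA.ne)]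
        with ω h1 h2
      rw [h1, h2]
      by_cases hωA : ω ∈ A <;> by_cases hωE : ω ∈ E <;> simp [hωA, hωE, mul_comm]
    · intro f f' hf hf' _ h h'
      simp only [map_add, h, h']
    · exact isClosed_eq (φ.continuous.comp (ContinuousLinearMap.continuous _))
        (ContinuousLinearMap.continuous _)
  set E : ℕ → Set Ω := fun n => {ω | |g ω| ≤ n} with hE
  have hEm : ∀ n, MeasurableSet (E n) := fun n => measurableSet_le hgm.abs measurable_const
  have hb : ∀ n ω, |(E n).indicator g ω| ≤ n := by
    intro n ω
    by_cases hω : ω ∈ E n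
    · rw [Set.indicator_of_mem hω]; exact hω
    · simp [hω]
  have hgL : MemLp g q P := by
    refine ⟨hgm.aestronglyMeasurable, ?_⟩
    refine lt_of_le_of_lt (Lp.eLpNorm_lim_le_liminf_eLpNorm (f := fun n => (E n).indicator g)
      (fun n => (hgm.indicator (hEm n)).aestronglyMeasurable) g ?_)
      (lt_of_le_of_lt (b := ENNReal.ofReal (‖φ‖ + 1)) ?_ ENNReal.ofReal_lt_top)
    · refine Filter.Eventually.of_forall fun ω => ?_
      refine tendsto_const_nhds.congr' ?_
      filter_upwards [Filter.eventually_ge_atTop ⌈|g ω|⌉₊] with n hn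
      rw [Set.indicator_of_mem]
      exact Nat.ceil_le.1 hn
    · refine Filter.liminf_le_of_le (by isBoundedDefault) ?_
      intro b hbn
      obtain ⟨n, hn⟩ := hbn.exists
      refine hn.trans (eLpNorm_le_of_integral_le hp (hgm.indicator (hEm n)) (norm_nonneg φ) ?_
        (hb n))
      intro f hf
      have hone : MemLp ((E n).indicator fun _ => (1 : ℝ)) ∞ P :=
        memLp_indicator_const _ (hEm n) _ (Or.inr (measure_ne_top _ _))
      have hG : MemLp ((E n).indicator g) q P :=
        memLp_of_abs_le (hgm.indicator (hEm n)) (hb n)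
      have hk := key hone.toLp (E n) (hEm n) hone.coeFn_toLp hG.toLp hG.coeFn_toLp hf.toLp
      rw [ContinuousLinearMap.lpPairing_eq_integral] at hk
      have h1 : ∫ ω, (E n).indicator g ω * f ω ∂P =
          ∫ ω, (ContinuousLinearMap.mul ℝ ℝ) ((hG.toLp _ : Ω → ℝ) ω) ((hf.toLp _ : Ω → ℝ) ω) ∂P := by
        refine integral_congr_ae ?_
        filter_upwards [hG.coeFn_toLp, hf.coeFn_toLp] with ω h1 h2
        rw [h1, h2]; rfl
      rw [h1, ← hk]
      refine (le_abs_self _).trans ((φ.le_opNorm _).trans ?_)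
      gcongr
      rw [← Lp.norm_toLp f hf]
      refine Lp.norm_le_norm_of_ae_le ?_
      filter_upwards [ContinuousLinearMap.coeFn_holder (r := p) (ContinuousLinearMap.mul ℝ ℝ)
        hone.toLp hf.toLp, hone.coeFn_toLp] with ω h2 h3
      refine (congrArg norm h2).le.trans ?_
      rw [h3]
      by_cases hω : ω ∈ E n <;> simp [hω]
  have hone : MemLp (Set.univ.indicator fun _ => (1 : ℝ)) ∞ P :=
    memLp_indicator_const _ MeasurableSet.univ _ (Or.inr (measure_ne_top _ _))
  refine ⟨hgL.toLp, fun f => ?_⟩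
  have hk := key hone.toLp Set.univ MeasurableSet.univ hone.coeFn_toLp hgL.toLp
    (by simpa using hgL.coeFn_toLp) f
  rw [ContinuousLinearMap.lpPairing_eq_integral] at hk
  refine Eq.trans ?_ hk
  congr 1
  refine Lp.ext ?_
  filter_upwards [ContinuousLinearMap.coeFn_holder (r := p) (ContinuousLinearMap.mul ℝ ℝ)
    hone.toLp f, hone.coeFn_toLp] with ω h2 h3
  refine Eq.trans ?_ h2.symm
  rw [h3]; simp

/-- Riesz representation: for `p < ∞` every continuous functional on `L^p_d` is a pairing. -/
lemma exists_eq_pairing [Fact (1 ≤ p)] [Fact (1 ≤ q)] [hpq : ENNReal.HolderConjugate p q]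
    (hp : p ≠ ∞) (φ : RV d p P →L[ℝ] ℝ) :
    ∃ y : RV d q P, ∀ x, φ x = pairing P y x := by
  classical
  set ι : Fin d → (ℝ →L[ℝ] (Fin d → ℝ)) := fun i =>
    ContinuousLinearMap.single ℝ (fun _ : Fin d => ℝ) i with hι
  choose g hg using fun i => exists_memLp_density (q := q) hp (φ ∘L (ι i).compLpL p P)
  have hy : MemLp (fun ω i => g i ω) q P := memLp_pi_iff.2 fun i => Lp.memLp (g i)
  refine ⟨hy.toLp, fun x => ?_⟩
  rw [pairing_congr hy.coeFn_toLp (Filter.EventuallyEq.refl _ _),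
    pairing_eq_sum hy (Lp.memLp x)]
  -- Splitting `x` into its coordinates reduces the vector case to the scalar one.
  have hx : x = ∑ i, (ι i).compLpL p P ((ContinuousLinearMap.proj (R := ℝ)
      (φ := fun _ : Fin d => ℝ) i).compLpL p P x) := by
    refine Lp.ext ?_
    have h1 : ∀ᵐ ω ∂P, ∀ i, (ι i).compLpL p P ((ContinuousLinearMap.proj (R := ℝ)
        (φ := fun _ : Fin d => ℝ) i).compLpL p P x) ω = Pi.single i (x ω i) := by
      refine ae_all_iff.2 fun i => ?_
      filter_upwards [ContinuousLinearMap.coeFn_compLpL (p := p) (ι i)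
        ((ContinuousLinearMap.proj (R := ℝ) (φ := fun _ : Fin d => ℝ) i).compLpL p P x),
        ContinuousLinearMap.coeFn_compLpL (p := p) (ContinuousLinearMap.proj (R := ℝ)
          (φ := fun _ : Fin d => ℝ) i) x] with ω h1 h2
      rw [h1, h2]; rfl
    filter_upwards [h1, Lp.coeFn_finsetSum (s := Finset.univ)
      (f := fun i => (ι i).compLpL p P ((ContinuousLinearMap.proj (R := ℝ)
        (φ := fun _ : Fin d => ℝ) i).compLpL p P x))] with ω h1 h2
    rw [h2, Finset.sum_apply]
    simp only [h1]
    exact (Finset.univ_sum_single (x ω)).symm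
  conv_lhs => rw [hx]
  rw [map_sum]
  refine Finset.sum_congr rfl fun i _ => ?_
  refine (hg i _).trans ?_
  refine integral_congr_ae ?_
  filter_upwards [ContinuousLinearMap.coeFn_compLpL (p := p) (ContinuousLinearMap.proj (R := ℝ)
          (φ := fun _ : Fin d => ℝ) i) x] with ω h2
  rw [h2]; rfl

end Riesz

/-! ### The topology of `L^p_d`, its continuous functionals and separation. -/

section Topology

variable {Ω : Type*} [m0 : MeasurableSpace Ω] {d : ℕ} {p q : ℝ≥0∞} {P : Measure Ω}

lemma topo_top [Fact (1 ≤ (∞ : ℝ≥0∞))] : topo d ∞ P =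
    TopologicalSpace.induced (fun (X : RV d ∞ P) (Y : RV d 1 P) => pairing P X Y)
      Pi.topologicalSpace := if_pos rfl

lemma topo_of_ne_top [Fact (1 ≤ p)] (hp : p ≠ ∞) :
    topo d p P = (inferInstance : TopologicalSpace (RV d p P)) := if_neg hp

lemma continuous_pair [Fact (1 ≤ p)] [Fact (1 ≤ q)] [hpq : ENNReal.HolderConjugate p q]
    (y : RV d q P) : @Continuous _ _ (topo d p P) _ (fun x : RV d p P => pairing P y x) := by
  by_cases hp : p = ∞
  · have hq : q = 1 := (ENNReal.HolderConjugate.eq_top_iff_eq_one p q).1 hp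
    subst hp hq
    rw [topo_top]
    have h1 : @Continuous _ _ (TopologicalSpace.induced
        (fun (X : RV d ∞ P) (Y : RV d 1 P) => pairing P X Y) Pi.topologicalSpace) _
        (fun (X : RV d ∞ P) (Y : RV d 1 P) => pairing P X Y) := continuous_induced_dom
    have h2 := @Continuous.comp _ _ _ (_) _ _ _ _ (continuous_apply (A := fun _ : RV d 1 P => ℝ) y) h1
    refine (Eq.mp ?_ h2)
    congr 1
    funext x
    exact pairing_comm _ _
  · rw [topo_of_ne_top hp]
    simp_rw [← pair_apply]
    exact (pair d p q P y).continuous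

/-- Pairings are norm continuous, so the weak* topology is coarser than the norm topology. Limits
along segments can therefore be taken in norm whatever `p` is. -/
lemma isClosed_of_topo [Fact (1 ≤ p)] [IsFiniteMeasure P] {S : Set (RV d p P)}
    (h : @IsClosed _ (topo d p P) S) : IsClosed S := by
  have hle : (inferInstance : TopologicalSpace (RV d p P)) ≤ topo d p P := by
    by_cases hp : p = ∞
    · subst hp
      rw [topo_top]
      refine continuous_iff_le_induced.1 (continuous_pi fun Y => ?_)
      have h : ENNReal.HolderConjugate ∞ 1 := ENNReal.HolderConjugate.top_one
      have : (fun X : RV d ∞ P => pairing P X Y) = pair d ∞ 1 P Y := by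
        funext X
        rw [pair_apply, pairing_comm]
      rw [this]
      exact (pair d ∞ 1 P Y).continuous
    · rw [topo_of_ne_top hp]
  exact IsClosed.mono h hle

/-- If `x + ε v` lies in a closed set for all small `ε > 0`, so does `x`. -/
lemma mem_of_forall_add_smul_mem [Fact (1 ≤ p)] [IsFiniteMeasure P] {S : Set (RV d p P)}
    (h : @IsClosed _ (topo d p P) S) {x v : RV d p P}
    (hx : ∀ ε : ℝ, 0 < ε → ε < 1 → x + ε • v ∈ S) : x ∈ S := by
  have hS := isClosed_of_topo h
  have hc : Filter.Tendsto (fun ε : ℝ => x + ε • v) (nhdsWithin 0 (Set.Ioi 0)) (nhds x) := by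
    have : Continuous fun ε : ℝ => x + ε • v := by fun_prop
    simpa using (this.tendsto 0).mono_left nhdsWithin_le_nhds
  refine hS.mem_of_tendsto hc ?_
  filter_upwards [Ioo_mem_nhdsGT (show (0 : ℝ) < 1 from one_pos)] with ε hε
  exact hx ε hε.1 hε.2

/-- Both cases are geometric Hahn-Banach; they differ in the identification of the dual. For `p = ∞`
the topology is that of `WeakBilin B`, whose continuous functionals are the evaluations at elements
of `L^1`; for `p < ∞` it is Riesz representation. -/
lemma exists_separating [Fact (1 ≤ p)] [Fact (1 ≤ q)] [hpq : ENNReal.HolderConjugate p q]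
    [IsFiniteMeasure P] {S : Set (RV d p P)} (hS : Convex ℝ S) (hc : @IsClosed _ (topo d p P) S)
    {x : RV d p P} (hx : x ∉ S) :
    ∃ (y : RV d q P) (c : ℝ), pairing P y x < c ∧ ∀ s ∈ S, c ≤ pairing P y s := by
  by_cases hp : p = ∞
  · have hq : q = 1 := (ENNReal.HolderConjugate.eq_top_iff_eq_one p q).1 hp
    subst hp hq
    set B : RV d ∞ P →ₗ[ℝ] RV d 1 P →ₗ[ℝ] ℝ :=
      ((ContinuousLinearMap.coeLM ℝ).comp (pair d ∞ 1 P).toLinearMap).flip with hB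
    have hBa : ∀ x y, B x y = pairing P y x := fun x y => pair_apply y x
    have hc' : @IsClosed (WeakBilin B) _ S := by
      rw [topo_top] at hc
      have e : (inferInstance : TopologicalSpace (WeakBilin B)) =
          TopologicalSpace.induced (fun (X : RV d ∞ P) (Y : RV d 1 P) => pairing P X Y)
            Pi.topologicalSpace :=
        congrArg (fun f : RV d ∞ P → RV d 1 P → ℝ =>
          TopologicalSpace.induced f Pi.topologicalSpace)
          (funext fun x => funext fun y => (hBa x y).trans (pairing_comm _ _))
      exact (congrArg (fun t => @IsClosed (RV d ∞ P) t S) e).mpr hc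
    obtain ⟨f, u, hfu, hv⟩ :=
      geometric_hahn_banach_point_closed (E := WeakBilin B) (x := x) (t := S) hS hc' hx
    obtain ⟨y, hy⟩ := LinearMap.dualEmbedding_surjective B f
    have hfy : ∀ z : RV d ∞ P, f z = pairing P y z := fun z => by
      rw [← hy]; exact hBa z y
    exact ⟨y, u, by rw [← hfy]; exact hfu, fun s hs => by rw [← hfy]; exact (hv s hs).le⟩
  · rw [topo_of_ne_top hp] at hc
    obtain ⟨f, u, hfu, hv⟩ := geometric_hahn_banach_point_closed hS hc hx
    obtain ⟨y, hy⟩ := exists_eq_pairing (q := q) hp f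
    exact ⟨y, u, by rw [← hy]; exact hfu, fun s hs => by rw [← hy]; exact (hv s hs).le⟩

end Topology

/-! ### The eligible portfolios form a closed subspace stable under `L^∞(𝓕_t)`. -/

section Eligible

variable {Ω : Type*} {𝓕t : MeasurableSpace Ω} [m0 : MeasurableSpace Ω] {d : ℕ} {p q : ℝ≥0∞}
  {P : Measure Ω} {Mtilde : Ω → Set (Fin d → ℝ)}

variable (𝓕t p P) in
/-- `M_t` as a subspace. -/
def eligibleSubmodule
    (hsub : ∀ᵐ ω ∂P, ∃ V : Submodule ℝ (Fin d → ℝ), Mtilde ω = (V : Set (Fin d → ℝ))) :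
    Submodule ℝ (RV d p P) where
  carrier := eligible 𝓕t Mtilde p P
  zero_mem' := by
    refine ⟨?_, ?_⟩
    · exact AEStronglyMeasurable.congr (f := fun _ => 0) aestronglyMeasurable_const
        (Lp.coeFn_zero _ p P).symm
    · filter_upwards [hsub, Lp.coeFn_zero (Fin d → ℝ) p P] with ω ⟨V, hV⟩ h
      rw [h, hV]; exact V.zero_mem
  add_mem' := by
    rintro x y ⟨hx, hx'⟩ ⟨hy, hy'⟩
    refine ⟨?_, ?_⟩
    · exact (AEStronglyMeasurable.add hx hy).congr (Lp.coeFn_add x y).symm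
    · filter_upwards [hsub, Lp.coeFn_add x y, hx', hy'] with ω ⟨V, hV⟩ h h1 h2
      rw [hV] at h1 h2 ⊢
      rw [h]; exact V.add_mem h1 h2
  smul_mem' := by
    rintro c x ⟨hx, hx'⟩
    refine ⟨?_, ?_⟩
    · exact (AEStronglyMeasurable.const_smul hx c).congr (Lp.coeFn_smul c x).symm
    · filter_upwards [hsub, Lp.coeFn_smul c x, hx'] with ω ⟨V, hV⟩ h h1
      rw [hV] at h1 ⊢
      rw [h]; exact V.smul_mem c h1

lemma lmul_mem_eligible
    (hsub : ∀ᵐ ω ∂P, ∃ V : Submodule ℝ (Fin d → ℝ), Mtilde ω = (V : Set (Fin d → ℝ)))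
    {l : Lp ℝ ∞ P} (hl : l ∈ LInf 𝓕t P) {x : RV d p P} (hx : x ∈ eligible 𝓕t Mtilde p P) :
    lmul l x ∈ eligible 𝓕t Mtilde p P := by
  refine ⟨?_, ?_⟩
  · exact (AEStronglyMeasurable.smul (f := l) hl hx.1).congr (lmul_coe l x).symm
  · filter_upwards [hsub, lmul_coe l x, hx.2] with ω ⟨V, hV⟩ h h1
    rw [hV] at h1 ⊢
    rw [h]; exact V.smul_mem _ h1

lemma isClosed_eligible_norm [Fact (1 ≤ p)] (h𝓕 : 𝓕t ≤ m0)
    (hsub : ∀ᵐ ω ∂P, ∃ V : Submodule ℝ (Fin d → ℝ), Mtilde ω = (V : Set (Fin d → ℝ))) :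
    IsClosed (eligible 𝓕t Mtilde p P) := by
  refine IsClosed.inter (isClosed_aestronglyMeasurable h𝓕) ?_
  refine isSeqClosed_iff_isClosed.1 ?_
  intro u x hu hx
  obtain ⟨ns, -, hns⟩ := (tendstoInMeasure_of_tendsto_Lp hx).exists_seq_tendsto_ae
  have hu' : ∀ᵐ ω ∂P, ∀ n, u n ω ∈ Mtilde ω := ae_all_iff.2 hu
  filter_upwards [hsub, hns, hu'] with ω ⟨V, hV⟩ h1 h2
  rw [hV] at h2 ⊢
  exact V.closed_of_finiteDimensional.mem_of_tendsto h1 (Filter.Eventually.of_forall fun n => h2 _)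

/-- For `p < ∞`, almost sure convergence along a subsequence suffices. For `p = ∞` that argument
fails in the weak* topology; instead, `M` is the trace on `L^∞` of the corresponding closed subspace
of `L^2`, which is an intersection of half-spaces given by `y ∈ L^2 ⊆ L^1`, and these are weak*
closed. -/
lemma isClosed_eligible [Fact (1 ≤ p)] [IsFiniteMeasure P] (h𝓕 : 𝓕t ≤ m0)
    (hsub : ∀ᵐ ω ∂P, ∃ V : Submodule ℝ (Fin d → ℝ), Mtilde ω = (V : Set (Fin d → ℝ))) :
    @IsClosed _ (topo d p P) (eligible 𝓕t Mtilde p P) := by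
  by_cases hp : p = ∞
  swap
  · rw [topo_of_ne_top hp]
    exact isClosed_eligible_norm h𝓕 hsub
  subst hp
  have h22 : ENNReal.HolderConjugate 2 2 := inferInstance
  have h1 : ENNReal.HolderConjugate ∞ 1 := ENNReal.HolderConjugate.top_one
  have hM2 : @IsClosed _ (topo d 2 P) (eligible 𝓕t Mtilde 2 P) := by
    rw [topo_of_ne_top ENNReal.ofNat_ne_top]
    exact isClosed_eligible_norm h𝓕 hsub
  have hconv : Convex ℝ (eligible 𝓕t Mtilde 2 P) := (eligibleSubmodule 𝓕t 2 P hsub).convex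
  have hmem2 : ∀ u : RV d ∞ P, MemLp u 2 P := fun u => (Lp.memLp u).mono_exponent le_top
  have hmem1 : ∀ y : RV d 2 P, MemLp y 1 P := fun y =>
    (Lp.memLp y).mono_exponent (by norm_num)
  have hiff : ∀ u : RV d ∞ P, u ∈ eligible 𝓕t Mtilde ∞ P ↔
      (hmem2 u).toLp ∈ eligible 𝓕t Mtilde 2 P := by
    intro u
    refine and_congr ⟨fun h => ?_, fun h => ?_⟩ (Filter.eventually_congr ?_)
    · exact AEStronglyMeasurable.congr h (hmem2 u).coeFn_toLp.symm
    · exact AEStronglyMeasurable.congr h (hmem2 u).coeFn_toLp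
    · filter_upwards [(hmem2 u).coeFn_toLp] with ω h
      rw [h]
  have hset : eligible 𝓕t Mtilde ∞ P = ⋂ (y : RV d 2 P) (c : ℝ)
      (_ : ∀ s ∈ eligible 𝓕t Mtilde 2 P, c ≤ pairing P y s),
      (fun u : RV d ∞ P => pairing P ((hmem1 y).toLp : RV d 1 P) u) ⁻¹' Set.Ici c := by
    ext u
    simp only [Set.mem_iInter, Set.mem_preimage, Set.mem_Ici]
    have hpair : ∀ y : RV d 2 P, pairing P ((hmem1 y).toLp : RV d 1 P) u =
        pairing P y (hmem2 u).toLp := fun y =>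
      pairing_congr (hmem1 y).coeFn_toLp (hmem2 u).coeFn_toLp.symm
    constructor
    · intro hu y c hc
      rw [hpair]
      exact hc _ ((hiff u).1 hu)
    · intro h
      rw [hiff]
      by_contra hu
      obtain ⟨y, c, hyc, hc⟩ := exists_separating (q := 2) hconv hM2 hu
      have := h y c hc
      rw [hpair] at this
      exact absurd this (not_le.2 hyc)
  rw [hset]
  exact @isClosed_iInter _ _ (topo d ∞ P) _ fun y => @isClosed_iInter _ _ (topo d ∞ P) _ fun c =>
    @isClosed_iInter _ _ (topo d ∞ P) _ fun _ =>
      @IsClosed.preimage _ _ (topo d ∞ P) _ _ (continuous_pair _) _ isClosed_Ici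

end Eligible

/-! ### Conditional expectations: pull-out rules and normalization. -/

section CondExp

variable {Ω : Type*} {m : MeasurableSpace Ω} [m0 : MeasurableSpace Ω] {P : Measure Ω}

/-- The measures with densities `g` and `condLExp m P g` have the same restriction to `m`, and an
`m`-measurable `f` sees only that restriction. -/
lemma lintegral_mul_condLExp [IsFiniteMeasure P] (hm : m ≤ m0) {f g : Ω → ℝ≥0∞}
    (hf : Measurable[m] f) (hg : AEMeasurable g P) :
    ∫⁻ ω, f ω * condLExp m P g ω ∂P = ∫⁻ ω, f ω * g ω ∂P := by
  have hf0 : Measurable f := hf.mono hm le_rfl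
  have h1 : ∀ k : Ω → ℝ≥0∞, AEMeasurable k P →
      ∫⁻ ω, f ω * k ω ∂P = ∫⁻ ω, f ω ∂((P.withDensity k).trim hm) := by
    intro k hk
    rw [lintegral_trim hm hf, lintegral_withDensity_eq_lintegral_mul₀ hk hf0.aemeasurable]
    simp only [Pi.mul_apply, mul_comm]
  rw [h1 _ hg, h1 _ (measurable_condLExp' m P g).aemeasurable]
  congr 1
  refine @Measure.ext _ m _ _ fun s hs => ?_
  rw [trim_measurableSet_eq hm hs, trim_measurableSet_eq hm hs, withDensity_apply _ (hm s hs),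
    withDensity_apply _ (hm s hs), setLIntegral_condLExp hm P g hs]

lemma condLExp_mul_left [IsFiniteMeasure P] (hm : m ≤ m0) {f g : Ω → ℝ≥0∞}
    (hf : Measurable[m] f) (hg : AEMeasurable g P) :
    condLExp m P (fun ω => f ω * g ω) =ᵐ[P] fun ω => f ω * condLExp m P g ω := by
  symm
  refine ae_eq_condLExp hm P _ (hf.mul (measurable_condLExp m P g)) fun s hs => ?_
  rw [← lintegral_indicator (hm s hs), ← lintegral_indicator (hm s hs)]
  have h := lintegral_mul_condLExp hm (f := s.indicator f) (hf.indicator hs) hg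
  convert h using 2 <;> · funext ω; by_cases hω : ω ∈ s <;> simp [hω]

lemma genCondExp_of_integrable {Z : Ω → ℝ} (hZ : Integrable Z P) :
    genCondExp m P Z =ᵐ[P] P[Z | m] := by
  have h1 := toReal_condLExp m (hZ.1.aemeasurable.ennreal_ofReal) (μ := P)
    (ne_of_lt (hZ.lintegral_lt_top))
  have h2 := toReal_condLExp m (hZ.neg.1.aemeasurable.ennreal_ofReal) (μ := P)
    (ne_of_lt (hZ.neg.lintegral_lt_top))
  have h3 := condExp_sub hZ.real_toNNReal hZ.neg.real_toNNReal m
  filter_upwards [h1, h2, h3, condExp_congr_ae (m := m) (μ := P)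
    (f := (fun a => ((Z a).toNNReal : ℝ)) - fun a => (((-Z) a).toNNReal : ℝ)) (g := Z)
    (Filter.Eventually.of_forall fun ω => by
      simp only [Pi.sub_apply, Real.coe_toNNReal', Pi.neg_apply, max_zero_sub_max_neg_zero_eq_self])]
    with ω h1 h2 h3 h4
  rw [genCondExp, ← h4, h3, Pi.sub_apply]
  exact congrArg₂ (· - ·) h1 h2

/-- Only `w Z` is assumed integrable, not `Z`: `diag(ξ) X` may fail to be integrable, while its
product with `w` is. The pull-out rule for nonnegative functions needs no integrability, so it is
applied to the positive and negative parts of `Z`. -/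
lemma mul_genCondExp [IsFiniteMeasure P] (hm : m ≤ m0) {w Z : Ω → ℝ}
    (hw : AEStronglyMeasurable[m] w P) (hZ : AEStronglyMeasurable Z P)
    (hwZ : Integrable (fun ω => w ω * Z ω) P) :
    (fun ω => w ω * genCondExp m P Z ω) =ᵐ[P] P[fun ω => w ω * Z ω | m] := by
  obtain ⟨v, hv, hwv⟩ := hw
  have hvZ : Integrable (fun ω => v ω * Z ω) P :=
    hwZ.congr (by filter_upwards [hwv] with ω h; rw [h])
  -- With the nonnegative factor `|v|` the parts of `Z` keep their signs; the `m`-measurable sign of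
  -- `v` is restored at the end.
  have habs : Integrable (fun ω => |v ω| * Z ω) P := by
    refine hvZ.mono ((hv.mono hm).measurable.abs.aestronglyMeasurable.mul hZ) ?_
    exact Filter.Eventually.of_forall fun ω => by simp
  have hpos : ∀ k : Ω → ℝ, AEMeasurable k P →
      condLExp m P (fun ω => ENNReal.ofReal (|v ω| * k ω)) =ᵐ[P]
        fun ω => ENNReal.ofReal |v ω| * condLExp m P (fun η => ENNReal.ofReal (k η)) ω := by
    intro k hk
    simp_rw [ENNReal.ofReal_mul (abs_nonneg _)]
    exact condLExp_mul_left hm (measurable_norm.comp hv.measurable).ennreal_ofReal hk.ennreal_ofReal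
  have h1 : (fun ω => |v ω| * genCondExp m P Z ω) =ᵐ[P] P[fun ω => |v ω| * Z ω | m] := by
    filter_upwards [hpos Z hZ.aemeasurable, hpos (fun ω => -Z ω) hZ.aemeasurable.neg,
      genCondExp_of_integrable (m := m) habs] with ω h1 h2 h3
    rw [← h3, genCondExp, genCondExp, h1]
    simp_rw [← mul_neg]
    rw [h2, ENNReal.toReal_mul, ENNReal.toReal_mul, ENNReal.toReal_ofReal (abs_nonneg _), mul_sub]
  have hB : MeasurableSet[m] {ω | 0 ≤ v ω} := measurableSet_le measurable_const hv.measurable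
  have hsm : StronglyMeasurable[m] fun ω => if 0 ≤ v ω then (1 : ℝ) else -1 :=
    (Measurable.ite hB measurable_const measurable_const).stronglyMeasurable
  have hsv : ∀ ω, (if 0 ≤ v ω then (1 : ℝ) else -1) * |v ω| = v ω := by
    intro ω
    split_ifs with h0
    · rw [abs_of_nonneg h0, one_mul]
    · rw [abs_of_neg (not_le.1 h0)]; ring
  have h2 := condExp_mul_of_stronglyMeasurable_left (μ := P) hsm (g := fun ω => |v ω| * Z ω)
    (by convert hvZ using 2 with ω; simp only [Pi.mul_apply]; rw [← mul_assoc, hsv]) habs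
  have h3 : P[fun ω => w ω * Z ω | m] =ᵐ[P]
      P[(fun ω => if 0 ≤ v ω then (1 : ℝ) else -1) * fun ω => |v ω| * Z ω | m] := by
    refine condExp_congr_ae ?_
    filter_upwards [hwv] with ω h
    rw [Pi.mul_apply, ← mul_assoc, hsv, h]
  filter_upwards [h1, h2, h3, hwv] with ω h1 h2 h3 h4
  rw [h3, h2, Pi.mul_apply, ← h1, h4, ← mul_assoc, hsv]

lemma integral_mul_eq_of_condExp_eq_one [IsFiniteMeasure P] (hm : m ≤ m0) {f ξ : Ω → ℝ}
    (hf : AEStronglyMeasurable[m] f P) (hξ : Integrable ξ P) (hfξ : Integrable (fun ω => f ω * ξ ω) P)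
    (h1 : P[ξ | m] =ᵐ[P] fun _ => 1) : ∫ ω, f ω * ξ ω ∂P = ∫ ω, f ω ∂P := by
  rw [← integral_condExp hm (f := fun ω => f ω * ξ ω)]
  refine integral_congr_ae ?_
  filter_upwards [condExp_mul_of_aestronglyMeasurable_left hf hfξ hξ, h1] with ω h h1
  refine h.trans ?_
  rw [Pi.mul_apply, h1, mul_one]

/-- A nonnegative integrable function vanishes where its conditional expectation does. -/
lemma ae_eq_zero_of_condExp_nonpos [IsFiniteMeasure P] (hm : m ≤ m0) {y c : Ω → ℝ}
    (hy : Integrable y P) (hy0 : 0 ≤ᵐ[P] y) (hcm : Measurable[m] c) (hc : c =ᵐ[P] P[y | m]) :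
    ∀ᵐ ω ∂P, c ω ≤ 0 → y ω = 0 := by
  set A := {ω | c ω ≤ 0}
  have hA : MeasurableSet[m] A := measurableSet_le hcm measurable_const
  have h1 : ∫ ω in A, y ω ∂P ≤ 0 := by
    rw [← setIntegral_condExp hm hy hA]
    refine integral_nonpos_of_ae ?_
    filter_upwards [ae_restrict_of_ae hc, ae_restrict_mem (hm _ hA)] with ω h h'
    rw [← h]; exact h'
  have h2 : y =ᵐ[P.restrict A] 0 :=
    (integral_eq_zero_iff_of_nonneg_ae (ae_restrict_of_ae hy0) hy.integrableOn).1
      (le_antisymm h1 (integral_nonneg_of_ae (ae_restrict_of_ae hy0)))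
  exact (ae_restrict_iff' (hm _ hA)).1 h2

/-- The normalization `y / E[y | m]`, set to `1` where the denominator vanishes, has conditional
expectation `1`. -/
lemma condLExp_ratio [IsFiniteMeasure P] (hm : m ≤ m0) {y c : Ω → ℝ}
    (hy : Integrable y P) (hy0 : 0 ≤ᵐ[P] y) (hcm : Measurable[m] c) (hc : c =ᵐ[P] P[y | m]) :
    condLExp m P (fun ω => ENNReal.ofReal (if 0 < c ω then y ω / c ω else 1)) =ᵐ[P]
      fun _ => 1 := by
  have hA : MeasurableSet[m] {ω | 0 < c ω} := measurableSet_lt measurable_const hcm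
  have hF : Measurable[m] fun ω => if 0 < c ω then (ENNReal.ofReal (c ω))⁻¹ else 0 :=
    Measurable.ite hA hcm.ennreal_ofReal.inv measurable_const
  have hG : Measurable[m] fun ω => if 0 < c ω then (0 : ℝ≥0∞) else 1 :=
    Measurable.ite hA measurable_const measurable_const
  -- The ratio is the sum of an `m`-measurable multiple of `y`, supported where `c > 0`, and the
  -- indicator of the complement. The first has conditional expectation 1 where `c > 0`, the second
  -- where it is not.
  have h1 := condLExp_mul_left hm hF (hy.1.aemeasurable.ennreal_ofReal)
  have h2 := condLExp_ofReal m hy hy0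
  have h3 := condLExp_add_right (mΩ := m) (P := P)
    (fun ω => (if 0 < c ω then (ENNReal.ofReal (c ω))⁻¹ else 0) * ENNReal.ofReal (y ω))
    (Y := fun ω => if 0 < c ω then (0 : ℝ≥0∞) else 1)
    (hG.mono hm le_rfl).aemeasurable
  have h4 : condLExp m P (fun ω => if 0 < c ω then (0 : ℝ≥0∞) else 1) =
      fun ω => if 0 < c ω then (0 : ℝ≥0∞) else 1 := condLExp_eq_self hm P hG
  have h5 : (fun ω => ENNReal.ofReal (if 0 < c ω then y ω / c ω else 1)) =
      (fun ω => (if 0 < c ω then (ENNReal.ofReal (c ω))⁻¹ else 0) * ENNReal.ofReal (y ω)) +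
        fun ω => if 0 < c ω then (0 : ℝ≥0∞) else 1 := by
    funext ω
    by_cases h0 : 0 < c ω
    · simp only [h0, if_true, Pi.add_apply, add_zero]
      rw [ENNReal.ofReal_div_of_pos h0, mul_comm, div_eq_mul_inv]
    · simp [h0]
  rw [h5]
  filter_upwards [h1, h2, h3, hc] with ω h1 h2 h3 hc
  rw [h3, Pi.add_apply, h1, h2, h4, ← hc]
  by_cases h0 : 0 < c ω
  · simp only [h0, if_true, add_zero]
    exact ENNReal.inv_mul_cancel (by simpa using h0) ENNReal.ofReal_ne_top
  · simp [h0]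

end CondExp

/-! ### The transition density `ξ` has conditional expectation 1. -/

section TransDensity

variable {Ω : Type*} [m0 : MeasurableSpace Ω] {d : ℕ} {p q : ℝ≥0∞} {P : Measure Ω}
  {𝓕 : Filtration ℕ m0} {T t : ℕ}

lemma density_nonneg (P Q : Measure Ω) (ω : Ω) : 0 ≤ density P Q ω := ENNReal.toReal_nonneg

lemma integrable_density (Q : Measure Ω) [IsFiniteMeasure Q] : Integrable (density P Q) P :=
  Measure.integrable_toReal_rnDeriv

lemma measurable_condExp_density (Q : Measure Ω) (s : ℕ) :
    Measurable[𝓕 s] (P[density P Q | 𝓕 s]) := stronglyMeasurable_condExp.measurable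

lemma condExp_density_nonneg (Q : Measure Ω) (s : ℕ) : 0 ≤ᵐ[P] P[density P Q | 𝓕 s] :=
  condExp_nonneg (Filter.Eventually.of_forall (density_nonneg P Q))

lemma measurable_stepDensity (Q : Measure Ω) (s : ℕ) :
    Measurable[𝓕 (s + 1)] (stepDensity 𝓕 P Q s) := by
  have h1 := (measurable_condExp_density (P := P) (𝓕 := 𝓕) Q s).mono
    (𝓕.mono (Nat.le_succ s)) le_rfl
  have hA : MeasurableSet[𝓕 (s + 1)] {ω | 0 < (P[density P Q | 𝓕 s]) ω} :=
    measurableSet_lt measurable_const h1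
  exact Measurable.ite hA ((measurable_condExp_density Q (s + 1)).div h1) measurable_const

lemma stepDensity_nonneg (Q : Measure Ω) (s : ℕ) : 0 ≤ᵐ[P] stepDensity 𝓕 P Q s := by
  filter_upwards [condExp_density_nonneg (P := P) (𝓕 := 𝓕) Q (s + 1)] with ω h
  simp only [stepDensity, Pi.zero_apply] at h ⊢
  split_ifs with h0
  · exact div_nonneg h h0.le
  · exact zero_le_one

lemma measurable_prod_stepDensity (Q : Measure Ω) {n : ℕ} :
    Measurable[𝓕 n] fun ω => ∏ s ∈ Finset.Ico t n, stepDensity 𝓕 P Q s ω := by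
  refine Finset.measurable_fun_prod _ fun s hs => ?_
  exact (measurable_stepDensity Q s).mono (𝓕.mono (Finset.mem_Ico.1 hs).2) le_rfl

lemma prod_stepDensity_nonneg (Q : Measure Ω) (n : ℕ) :
    ∀ᵐ ω ∂P, 0 ≤ ∏ s ∈ Finset.Ico t n, stepDensity 𝓕 P Q s ω := by
  have : ∀ᵐ ω ∂P, ∀ s, 0 ≤ stepDensity 𝓕 P Q s ω := ae_all_iff.2 fun s => stepDensity_nonneg Q s
  filter_upwards [this] with ω h
  exact Finset.prod_nonneg fun s _ => h s

lemma measurable_transDensity (Q : Fin d → Measure Ω) (i : Fin d) :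
    Measurable fun ω => transDensity 𝓕 T t P Q ω i :=
  (measurable_prod_stepDensity (Q i)).mono (𝓕.le T) le_rfl

variable [IsFiniteMeasure P]

lemma condLExp_stepDensity (Q : Measure Ω) [IsFiniteMeasure Q] (s : ℕ) :
    condLExp (𝓕 s) P (fun ω => ENNReal.ofReal (stepDensity 𝓕 P Q s ω)) =ᵐ[P] fun _ => 1 :=
  condLExp_ratio (𝓕.le s) integrable_condExp (condExp_density_nonneg Q (s + 1))
    (measurable_condExp_density Q s)
    (condExp_condExp_of_le (𝓕.mono (Nat.le_succ s)) (𝓕.le (s + 1))).symm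

/-- Tower property: conditioning on `𝓕 n` removes the last factor, whose conditional expectation is
1. Lower integrals are used because integrability of the product is itself a consequence. -/
lemma setLIntegral_prod_stepDensity (Q : Measure Ω) [IsFiniteMeasure Q] {n : ℕ} (hn : t ≤ n)
    {A : Set Ω} (hA : MeasurableSet[𝓕 t] A) :
    ∫⁻ ω in A, ENNReal.ofReal (∏ s ∈ Finset.Ico t n, stepDensity 𝓕 P Q s ω) ∂P = P A := by
  induction n, hn using Nat.le_induction with
  | base => simp
  | succ n hn ih =>
    have hA0 := 𝓕.le t _ hA
    rw [← ih, ← lintegral_indicator hA0, ← lintegral_indicator hA0]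
    set f : Ω → ℝ≥0∞ := A.indicator fun ω =>
      ENNReal.ofReal (∏ s ∈ Finset.Ico t n, stepDensity 𝓕 P Q s ω) with hf
    have hfm : Measurable[𝓕 n] f :=
      (measurable_prod_stepDensity Q).ennreal_ofReal.indicator (𝓕.mono hn _ hA)
    have h1 := lintegral_mul_condLExp (𝓕.le n) hfm (P := P)
      (((measurable_stepDensity (P := P) (𝓕 := 𝓕) Q n).mono
        (𝓕.le _) le_rfl).ennreal_ofReal.aemeasurable)
    have h2 : ∫⁻ ω, f ω ∂P = ∫⁻ ω, f ω *
        condLExp (𝓕 n) P (fun ω => ENNReal.ofReal (stepDensity 𝓕 P Q n ω)) ω ∂P := by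
      refine lintegral_congr_ae ?_
      filter_upwards [condLExp_stepDensity (P := P) (𝓕 := 𝓕) Q n] with ω h
      rw [h, mul_one]
    rw [h2, h1]
    refine lintegral_congr_ae ?_
    filter_upwards [stepDensity_nonneg (P := P) (𝓕 := 𝓕) Q n] with ω h
    by_cases hω : ω ∈ A
    · simp only [hf, Set.indicator_of_mem hω]
      rw [Finset.prod_Ico_succ_top hn, ENNReal.ofReal_mul' h]
    · simp [hf, hω]

lemma integrable_transDensity (htT : t ≤ T) (Q : Fin d → Measure Ω) (i : Fin d)
    [IsFiniteMeasure (Q i)] : Integrable (fun ω => transDensity 𝓕 T t P Q ω i) P := by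
  refine ⟨(measurable_transDensity Q i).aestronglyMeasurable, ?_⟩
  refine (hasFiniteIntegral_iff_ofReal (prod_stepDensity_nonneg (Q i) T)).2 ?_
  have := setLIntegral_prod_stepDensity (P := P) (𝓕 := 𝓕) (Q i) htT MeasurableSet.univ
  rw [setLIntegral_univ] at this
  exact this ▸ measure_lt_top P _

lemma condExp_transDensity (htT : t ≤ T) (Q : Fin d → Measure Ω) (i : Fin d)
    [IsFiniteMeasure (Q i)] : P[fun ω => transDensity 𝓕 T t P Q ω i | 𝓕 t] =ᵐ[P] fun _ => 1 := by
  have h1 := ae_eq_condLExp (𝓕.le t) P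
    (fun ω => ENNReal.ofReal (transDensity 𝓕 T t P Q ω i)) (Y := fun _ => 1) measurable_const
    fun A hA => by
      rw [setLIntegral_one]; exact (setLIntegral_prod_stepDensity (Q i) htT hA).symm
  have h2 := toReal_condLExp (𝓕 t) (μ := P)
    (f := fun ω => ENNReal.ofReal (transDensity 𝓕 T t P Q ω i))
    (measurable_transDensity Q i).ennreal_ofReal.aemeasurable
    (integrable_transDensity htT Q i).lintegral_lt_top.ne
  have h3 : P[fun ω => (ENNReal.ofReal (transDensity 𝓕 T t P Q ω i)).toReal | 𝓕 t] =ᵐ[P]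
      P[fun ω => transDensity 𝓕 T t P Q ω i | 𝓕 t] := by
    refine condExp_congr_ae ?_
    filter_upwards [prod_stepDensity_nonneg (P := P) (𝓕 := 𝓕) (t := t) (Q i) T] with ω h
    exact ENNReal.toReal_ofReal h
  filter_upwards [h1, h2, h3] with ω h1 h2 h3
  rw [← h3, ← h2, ← h1]; rfl

/-- If `E[dQ/dP | 𝓕_t] = 1`, the transition density is `dQ/dP`. -/
lemma transDensity_ae_eq (h𝓕T : 𝓕 T = m0) (htT : t ≤ T) (Q : Fin d → Measure Ω) (i : Fin d)
    [IsFiniteMeasure (Q i)] (h1 : P[density P (Q i) | 𝓕 t] =ᵐ[P] fun _ => 1) :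
    (fun ω => transDensity 𝓕 T t P Q ω i) =ᵐ[P] density P (Q i) := by
  have key : ∀ n, t ≤ n → (fun ω => ∏ s ∈ Finset.Ico t n, stepDensity 𝓕 P (Q i) s ω) =ᵐ[P]
      P[density P (Q i) | 𝓕 n] := by
    intro n hn
    induction n, hn using Nat.le_induction with
    | base => filter_upwards [h1] with ω h; simp [h]
    | succ n hn ih =>
      -- The product telescopes. Where the denominator at time `n` vanishes, the next conditional
      -- expectation vanishes too, so the conventional factor 1 does no harm.
      have h0 := ae_eq_zero_of_condExp_nonpos (𝓕.le n) (P := P) (y := P[density P (Q i) | 𝓕 (n + 1)])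
        integrable_condExp (condExp_density_nonneg (Q i) (n + 1))
        (measurable_condExp_density (Q i) n)
        (condExp_condExp_of_le (𝓕.mono (Nat.le_succ n)) (𝓕.le (n + 1))).symm
      filter_upwards [ih, h0, condExp_density_nonneg (P := P) (𝓕 := 𝓕) (Q i) n] with ω h h0 hn0
      rw [Finset.prod_Ico_succ_top hn, h, stepDensity]
      split_ifs with hpos
      · rw [mul_div_cancel₀ _ hpos.ne']
      · rw [h0 (not_lt.1 hpos), le_antisymm (not_lt.1 hpos) hn0, zero_mul]
  refine (key T htT).trans ?_
  rw [h𝓕T]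
  rw [condExp_of_stronglyMeasurable le_rfl _ (integrable_density (Q i))]
  exact (Measure.measurable_rnDeriv _ _).ennreal_toReal.stronglyMeasurable

end TransDensity

/-! ### The properties of `M` on which the duality rests. -/

section Eligible

variable {Ω : Type*} (𝓕t : MeasurableSpace Ω) [m0 : MeasurableSpace Ω] {d : ℕ} {p : ℝ≥0∞}
  {P : Measure Ω}

/-- The properties of the space `M_t` of eligible portfolios that the duality uses. -/
structure IsEligible [Fact (1 ≤ p)] (M : Submodule ℝ (RV d p P)) :
    Prop where
  mem_LpAt : ∀ u ∈ M, u ∈ LpAt 𝓕t d p P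
  lmul_mem : ∀ l ∈ LInf 𝓕t P, ∀ u ∈ M, lmul l u ∈ M
  isClosed : @IsClosed _ (topo d p P) (M : Set (RV d p P))

end Eligible

/-! ### Construction of `𝓕_t`-measurable bounded scalars and their action. -/

section Scalars

variable {Ω : Type*} {𝓕t : MeasurableSpace Ω} [m0 : MeasurableSpace Ω] {d : ℕ} {p : ℝ≥0∞}
  {P : Measure Ω}

lemma exists_LInf [IsFiniteMeasure P] (h𝓕 : 𝓕t ≤ m0) {f : Ω → ℝ} (hf : Measurable[𝓕t] f) {B : ℝ}
    (hB : ∀ ω, |f ω| ≤ B) : ∃ k ∈ LInf 𝓕t P, k =ᵐ[P] f := by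
  have h : MemLp f ∞ P := memLp_of_abs_le (hf.mono h𝓕 le_rfl) hB
  refine ⟨h.toLp, ?_, h.coeFn_toLp⟩
  exact AEStronglyMeasurable.congr (f := f) hf.stronglyMeasurable.aestronglyMeasurable
    h.coeFn_toLp.symm

lemma lmul_mem_LpAt {l : Lp ℝ ∞ P} (hl : l ∈ LInf 𝓕t P) {x : RV d p P} (hx : x ∈ LpAt 𝓕t d p P) :
    lmul l x ∈ LpAt 𝓕t d p P :=
  (AEStronglyMeasurable.smul (f := l) hl hx).congr (lmul_coe l x).symm

lemma lmul_mem_posCone {l : Lp ℝ ∞ P} (hl : ∀ᵐ ω ∂P, 0 ≤ l ω) {x : RV d p P}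
    (hx : x ∈ posCone d p P) : lmul l x ∈ posCone d p P := by
  filter_upwards [hl, hx, lmul_coe l x] with ω h1 h2 h3 i
  rw [h3]
  exact mul_nonneg h1 (h2 i)

end Scalars

/-! ### Dual pairs `(Q, w)` as nonnegative elements of `L^q_d`. -/

section DualVec

variable {Ω : Type*} [m0 : MeasurableSpace Ω] {d : ℕ} {p q : ℝ≥0∞} {P : Measure Ω}
  {𝓕 : Filtration ℕ m0} {T t : ℕ}

open Classical in
variable (𝓕 T t) in
/-- `dualDensity` as an element of `L^q_d`. -/
def dualVec (z : (Fin d → Measure Ω) × RV d q P) : RV d q P :=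
  if h : MemLp (dualDensity 𝓕 T t z.1 z.2) q P then h.toLp else 0

lemma dualVec_coe {z : (Fin d → Measure Ω) × RV d q P}
    (h : MemLp (dualDensity 𝓕 T t z.1 z.2) q P) :
    dualVec 𝓕 T t z =ᵐ[P] dualDensity 𝓕 T t z.1 z.2 := by
  rw [dualVec, dif_pos h]
  exact h.coeFn_toLp

variable {M : Submodule ℝ (RV d p P)} {z : (Fin d → Measure Ω) × RV d q P}

lemma pairing_dualDensity (hz : z ∈ dualVars 𝓕 T t q (M : Set (RV d p P))) (X : RV d p P) :
    pairing P (dualDensity 𝓕 T t z.1 z.2) X = pairing P (dualVec 𝓕 T t z) X :=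
  pairing_congr (dualVec_coe hz.2.2.1).symm (Filter.EventuallyEq.refl _ _)

lemma dualVec_mem_posCone (hz : z ∈ dualVars 𝓕 T t q (M : Set (RV d p P))) :
    dualVec 𝓕 T t z ∈ posCone d q P := by
  filter_upwards [dualVec_coe hz.2.2.1, hz.2.2.2] with ω h1 h2
  rw [h1]; exact h2

variable [IsFiniteMeasure P]

/-- Each `w_i u_i` is `𝓕_t`-measurable and `ξ_i` has conditional expectation 1 given `𝓕_t`, so `ξ_i`
drops out of the integral. -/
lemma pairing_dualVec_of_mem_LpAt [ENNReal.HolderConjugate p q] (htT : t ≤ T)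
    (hz : z ∈ dualVars 𝓕 T t q (M : Set (RV d p P))) {u : RV d p P} (hu : u ∈ LpAt (𝓕 t) d p P) :
    pairing P (dualVec 𝓕 T t z) u = pairing P z.2 u := by
  rw [← pairing_dualDensity hz, pairing_eq_sum hz.2.2.1 (Lp.memLp u),
    pairing_eq_sum (Lp.memLp z.2) (Lp.memLp u)]
  refine Finset.sum_congr rfl fun i _ => ?_
  have := (hz.1 i).1
  have hint := integrable_dotProduct hz.2.2.1 (Lp.memLp u) i
  have he : ∀ ω, dualDensity 𝓕 T t z.1 z.2 ω i * u ω i =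
      (z.2 ω i * u ω i) * transDensity 𝓕 T t P z.1 ω i := fun ω => by
    rw [dualDensity]; ring
  simp only [he] at hint ⊢
  have hw : AEStronglyMeasurable[𝓕 t] z.2 P := hz.2.1.1.1
  refine integral_mul_eq_of_condExp_eq_one (𝓕.le t) ?_ (integrable_transDensity htT z.1 i) hint
    (condExp_transDensity htT z.1 i)
  exact ((continuous_apply i).comp_aestronglyMeasurable hw).mul
    ((continuous_apply i).comp_aestronglyMeasurable hu)

/-- Each `w_i` is `𝓕_t`-measurable and can be moved inside the generalized conditional expectation
by `mul_genCondExp`; integrating then removes the conditioning. -/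
lemma pairing_qCondExp [ENNReal.HolderConjugate p q]
    (hz : z ∈ dualVars 𝓕 T t q (M : Set (RV d p P))) (X : RV d p P) :
    pairing P z.2 (qCondExp 𝓕 T t P z.1 X) = pairing P (dualVec 𝓕 T t z) X := by
  rw [← pairing_dualDensity hz, pairing_eq_sum hz.2.2.1 (Lp.memLp X), pairing]
  have hint := integrable_dotProduct hz.2.2.1 (Lp.memLp X)
  have hw : AEStronglyMeasurable[𝓕 t] z.2 P := hz.2.1.1.1
  have he : ∀ i ω, dualDensity 𝓕 T t z.1 z.2 ω i * X ω i =
      z.2 ω i * (transDensity 𝓕 T t P z.1 ω i * X ω i) := fun i ω => by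
    rw [dualDensity]; ring
  simp only [he] at hint ⊢
  have hX : AEStronglyMeasurable X P := (Lp.memLp X).1
  have hmul : ∀ i, (fun ω => z.2 ω i * qCondExp 𝓕 T t P z.1 X ω i) =ᵐ[P]
      P[fun ω => z.2 ω i * (transDensity 𝓕 T t P z.1 ω i * X ω i) | 𝓕 t] := fun i =>
    mul_genCondExp (𝓕.le t) ((continuous_apply i).comp_aestronglyMeasurable hw)
      ((measurable_transDensity z.1 i).aestronglyMeasurable.mul
        ((continuous_apply i).comp_aestronglyMeasurable hX)) (hint i)
  simp only [dotProduct]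
  rw [integral_finsetSum _ fun i _ => integrable_condExp.congr (hmul i).symm]
  refine Finset.sum_congr rfl fun i _ => ?_
  rw [integral_congr_ae (hmul i), integral_condExp (𝓕.le t)]

lemma dualFun_eq [Fact (1 ≤ p)] [ENNReal.HolderConjugate p q] (hM : IsEligible (𝓕 t) M)
    (htT : t ≤ T) (hz : z ∈ dualVars 𝓕 T t q (M : Set (RV d p P))) (X : RV d p P) :
    dualFun 𝓕 T t (M : Set (RV d p P)) z X =
      {u | u ∈ M ∧ pairing P (dualVec 𝓕 T t z) X ≤ pairing P (dualVec 𝓕 T t z) u} := by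
  ext u
  simp only [dualFun, Set.mem_ofPred_eq, SetLike.mem_coe]
  refine and_congr_right fun hu => ?_
  rw [pairing_qCondExp hz, pairing_dualVec_of_mem_LpAt htT hz (hM.mem_LpAt u hu)]

lemma exists_pairing_dualVec_pos [Fact (1 ≤ p)] [Fact (1 ≤ q)] [ENNReal.HolderConjugate p q]
    (hM : IsEligible (𝓕 t) M) (htT : t ≤ T) (hz : z ∈ dualVars 𝓕 T t q (M : Set (RV d p P))) :
    ∃ v ∈ M, 0 < pairing P (dualVec 𝓕 T t z) v := by
  have h := hz.2.1.2
  have hw := hz.2.1.1.1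
  simp only [perp, Set.mem_ofPred_eq, not_and, not_forall, SetLike.mem_coe] at h
  obtain ⟨v, hv, hne⟩ := h hw
  rw [← pairing_dualVec_of_mem_LpAt htT hz (hM.mem_LpAt v hv)] at hne
  rcases lt_or_gt_of_ne hne with h0 | h0
  · refine ⟨-v, M.neg_mem hv, ?_⟩
    rw [← pair_apply, map_neg, pair_apply]
    linarith
  · exact ⟨v, hv, h0⟩

/-- The delicate point is that `l w` stays outside the annihilator of `M` although `l` need not be
bounded away from 0. Stability of `M` under `L^∞(𝓕_t)` settles it. -/
lemma lmul_mem_dualVars [Fact (1 ≤ p)] [Fact (1 ≤ q)] [ENNReal.HolderConjugate p q]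
    (hM : IsEligible (𝓕 t) M) {l : Lp ℝ ∞ P} (hl : l ∈ LInf (𝓕 t) P) (hpos : ∀ᵐ ω ∂P, 0 < l ω)
    (hz : z ∈ dualVars 𝓕 T t q (M : Set (RV d p P))) :
    (z.1, lmul l z.2) ∈ dualVars 𝓕 T t q (M : Set (RV d p P)) ∧
      dualVec 𝓕 T t (z.1, lmul l z.2) = lmul l (dualVec 𝓕 T t z) := by
  have hw := hz.2.1.1.1
  have hcoe : dualDensity 𝓕 T t z.1 (lmul l z.2) =ᵐ[P] lmul l (dualVec 𝓕 T t z) := by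
    filter_upwards [lmul_coe l z.2, lmul_coe l (dualVec 𝓕 T t z), dualVec_coe hz.2.2.1]
      with ω h1 h2 h3
    funext i
    rw [dualDensity, h1, h2, h3, Pi.smul_apply, Pi.smul_apply, smul_mul_assoc]
    rfl
  have hmem : MemLp (dualDensity 𝓕 T t z.1 (lmul l z.2)) q P := (Lp.memLp _).ae_eq hcoe.symm
  refine ⟨⟨hz.1, ⟨⟨lmul_mem_LpAt hl hw, fun u hu => ?_⟩, fun hperp => ?_⟩, hmem, ?_⟩, ?_⟩
  · rw [pairing_lmul]
    exact hz.2.1.1.2 _ ⟨hM.lmul_mem l hl u hu.1,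
      lmul_mem_posCone (hpos.mono fun ω h => h.le) hu.2⟩
  · refine hz.2.1.2 ⟨hw, fun v hv => ?_⟩
    have hdot : AEStronglyMeasurable[𝓕 t] (fun ω => z.2 ω ⬝ᵥ v ω) P := by
      have hcont : Continuous fun x : (Fin d → ℝ) × (Fin d → ℝ) => x.1 ⬝ᵥ x.2 := by fun_prop
      exact hcont.comp_aestronglyMeasurable (AEStronglyMeasurable.prodMk hw (hM.mem_LpAt v hv))
    obtain ⟨h, hh, hheq⟩ := hdot
    have hB : MeasurableSet[𝓕 t] {ω | 0 ≤ h ω} := measurableSet_le measurable_const hh.measurable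
    -- Here `k` is the sign of `wᵀv`. As `k v ∈ M`, annihilation by `l w` gives `E[l |wᵀv|] = 0`,
    -- and `l > 0` forces `wᵀv = 0`.
    obtain ⟨k, hk, hkeq⟩ := exists_LInf (P := P) (𝓕.le t) (B := 1)
      (f := fun ω => if 0 ≤ h ω then (1 : ℝ) else -1)
      (Measurable.ite hB measurable_const measurable_const)
      (fun ω => by split_ifs <;> simp)
    have h0 : ∫ ω, l ω * |h ω| ∂P = 0 := by
      rw [← hperp.2 (lmul k v) (hM.lmul_mem k hk v hv), pairing_lmul]
      refine integral_congr_ae ?_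
      filter_upwards [lmul_coe l (lmul k v), lmul_coe k v, hkeq, hheq] with ω h1 h2 h3 h4
      rw [h1, h2, h3, dotProduct_smul, dotProduct_smul, h4]
      simp only [smul_eq_mul]
      split_ifs with h0
      · rw [abs_of_nonneg h0, one_mul]
      · rw [abs_of_neg (not_le.1 h0), neg_one_mul]
    have hint : Integrable (fun ω => l ω * |h ω|) P := by
      have h1 : Integrable (fun ω => z.2 ω ⬝ᵥ v ω) P := by
        simp only [dotProduct]
        exact integrable_finsetSum _ fun i _ => integrable_dotProduct (Lp.memLp z.2) (Lp.memLp v) i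
      have h2 : Integrable (fun ω => |h ω|) P :=
        (h1.congr (by filter_upwards [hheq] with ω h; rw [h])).abs
      exact (Lp.memLp l).integrable_mul (p := ∞) (q := 1) (memLp_one_iff_integrable.2 h2)
    have h1 := (integral_eq_zero_iff_of_nonneg_ae
      (by filter_upwards [hpos] with ω h1; exact mul_nonneg h1.le (abs_nonneg _)) hint).1 h0
    refine integral_eq_zero_of_ae ?_
    filter_upwards [h1, hpos, hheq] with ω h1 h2 h3
    rw [h3]
    simpa [h2.ne'] using h1
  · filter_upwards [hcoe, lmul_mem_posCone (hpos.mono fun ω h => h.le) (dualVec_mem_posCone hz)]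
      with ω h1 h2
    rw [h1]; exact h2
  · refine Lp.ext ?_
    exact (dualVec_coe (z := (z.1, lmul l z.2)) hmem).trans hcoe

/-- Every nonnegative functional that does not vanish on `M` comes from a dual variable. -/
lemma exists_dualVar [Fact (1 ≤ p)] [Fact (1 ≤ q)] [ENNReal.HolderConjugate p q]
    (hM : IsEligible (𝓕 t) M) (h𝓕T : 𝓕 T = m0) (htT : t ≤ T) [IsProbabilityMeasure P]
    {Y : RV d q P} (hY : Y ∈ posCone d q P) {v : RV d p P} (hv : v ∈ M)
    (hne : pairing P Y v ≠ 0) :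
    ∃ z ∈ dualVars 𝓕 T t q (M : Set (RV d p P)), dualVec 𝓕 T t z = Y := by
  have hYi : ∀ i, MemLp (fun ω => Y ω i) q P := memLp_pi_iff.1 (Lp.memLp Y)
  have hYint : ∀ i, Integrable (fun ω => Y ω i) P := fun i => (hYi i).integrable Fact.out
  have hY0 : ∀ i, 0 ≤ᵐ[P] fun ω => Y ω i := fun i => by
    filter_upwards [hY] with ω h; exact h i
  -- Disintegration of `Y`: the part known at time `t` becomes `w = E[Y | 𝓕_t]`, and the normalized
  -- remainder `ζ = Y / w` becomes the density of `Q`. Since `E[ζ_i | 𝓕_t] = 1`, each `Q i` is a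
  -- probability measure whose transition density is `ζ_i`.
  set c : Fin d → Ω → ℝ := fun i => P[fun ω => Y ω i | 𝓕 t] with hc
  have hcm : ∀ i, Measurable[𝓕 t] (c i) := fun i => stronglyMeasurable_condExp.measurable
  have hcL : MemLp (fun ω i => c i ω) q P :=
    memLp_pi_iff.2 fun i => (hYi i).condExp Fact.out
  set ζ : Fin d → Ω → ℝ := fun i ω => if 0 < c i ω then Y ω i / c i ω else 1 with hζ
  have hζm : ∀ i, AEMeasurable (ζ i) P := fun i => by
    have hci := (hcm i).mono (𝓕.le t) le_rfl
    have h1 : Measurable fun ω => if 0 < c i ω then (hYi i).1.mk _ ω / c i ω else 1 :=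
      Measurable.ite (measurableSet_lt measurable_const hci)
        ((hYi i).1.stronglyMeasurable_mk.measurable.div hci) measurable_const
    refine h1.aemeasurable.congr ?_
    filter_upwards [(hYi i).1.ae_eq_mk] with ω h
    simp only [hζ, ← h]
  have hζ0 : ∀ i, 0 ≤ᵐ[P] ζ i := fun i => by
    filter_upwards [hY0 i] with ω h
    simp only [hζ, Pi.zero_apply] at h ⊢
    split_ifs with h0
    · exact div_nonneg h h0.le
    · exact zero_le_one
  have hratio : ∀ i, condLExp (𝓕 t) P (fun ω => ENNReal.ofReal (ζ i ω)) =ᵐ[P] fun _ => 1 :=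
    fun i => condLExp_ratio (𝓕.le t) (hYint i) (hY0 i) (hcm i) (Filter.EventuallyEq.refl _ _)
  have hlint : ∀ i, ∫⁻ ω, ENNReal.ofReal (ζ i ω) ∂P = 1 := fun i => by
    rw [← lintegral_condLExp (𝓕.le t) P, lintegral_congr_ae (hratio i)]
    simp
  set Q : Fin d → Measure Ω := fun i => P.withDensity fun ω => ENNReal.ofReal (ζ i ω) with hQ
  have hQp : ∀ i, IsProbabilityMeasure (Q i) := fun i =>
    ⟨by rw [hQ, withDensity_apply _ MeasurableSet.univ, setLIntegral_univ, hlint]⟩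
  have hdens : ∀ i, density P (Q i) =ᵐ[P] ζ i := fun i => by
    filter_upwards [Measure.rnDeriv_withDensity₀ P (hζm i).ennreal_ofReal, hζ0 i] with ω h1 h2
    rw [density, h1, ENNReal.toReal_ofReal h2]
  have hone : ∀ i, P[density P (Q i) | 𝓕 t] =ᵐ[P] fun _ => 1 := fun i => by
    have h2 := toReal_condLExp (𝓕 t) (μ := P) (f := fun ω => ENNReal.ofReal (ζ i ω))
      (hζm i).ennreal_ofReal (by rw [hlint]; exact ENNReal.one_ne_top)
    have h3 : P[fun ω => (ENNReal.ofReal (ζ i ω)).toReal | 𝓕 t] =ᵐ[P]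
        P[density P (Q i) | 𝓕 t] := by
      refine condExp_congr_ae ?_
      filter_upwards [hdens i, hζ0 i] with ω h1 h2
      rw [h1, ENNReal.toReal_ofReal h2]
    filter_upwards [hratio i, h2, h3] with ω h1 h2 h3
    rw [← h3, ← h2, h1]; rfl
  set w : RV d q P := hcL.toLp with hw
  have hdd : dualDensity 𝓕 T t Q w =ᵐ[P] Y := by
    have h1 : ∀ᵐ ω ∂P, ∀ i, dualDensity 𝓕 T t Q w ω i = Y ω i := by
      refine ae_all_iff.2 fun i => ?_
      filter_upwards [hcL.coeFn_toLp, transDensity_ae_eq h𝓕T htT Q i (hone i), hdens i,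
        -- Where `c i` vanishes so does `Y i`, hence `w_i ζ_i = Y_i` holds there as well.
        ae_eq_zero_of_condExp_nonpos (𝓕.le t) (hYint i) (hY0 i) (hcm i)
          (Filter.EventuallyEq.refl _ _), condExp_nonneg (m := 𝓕 t) (hY0 i)] with ω h1 h2 h3 h4 h5
      rw [dualDensity, h1, h2, h3]
      simp only [hζ]
      split_ifs with h0
      · rw [mul_div_cancel₀ _ h0.ne']
      · rw [h4 (not_lt.1 h0), le_antisymm (not_lt.1 h0) h5, zero_mul]
    filter_upwards [h1] with ω h
    exact funext h
  have hmem : MemLp (dualDensity 𝓕 T t Q w) q P := (Lp.memLp Y).ae_eq hdd.symm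
  have hwt : w ∈ LpAt (𝓕 t) d q P := by
    refine AEStronglyMeasurable.congr (f := fun ω i => c i ω) ?_ hcL.coeFn_toLp.symm
    exact (@measurable_pi_lambda _ _ _ (𝓕 t) _ _ hcm).stronglyMeasurable.aestronglyMeasurable
  have hpair : ∀ u ∈ M, pairing P w u = pairing P Y u := by
    intro u hu
    rw [← pairing_congr hdd (Filter.EventuallyEq.refl _ u),
      pairing_eq_sum hmem (Lp.memLp u), pairing_eq_sum (Lp.memLp w) (Lp.memLp u)]
    refine Finset.sum_congr rfl fun i _ => ?_
    have hint := integrable_dotProduct hmem (Lp.memLp u) i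
    have he : ∀ ω, dualDensity 𝓕 T t Q w ω i * u ω i =
        (w ω i * u ω i) * transDensity 𝓕 T t P Q ω i := fun ω => by
      rw [dualDensity]; ring
    simp only [he] at hint ⊢
    refine (integral_mul_eq_of_condExp_eq_one (𝓕.le t) ?_ (integrable_transDensity htT Q i) hint
      (condExp_transDensity htT Q i)).symm
    exact ((continuous_apply i).comp_aestronglyMeasurable hwt).mul
      ((continuous_apply i).comp_aestronglyMeasurable (hM.mem_LpAt u hu))
  refine ⟨(Q, w), ⟨fun i => ⟨hQp i, withDensity_absolutelyContinuous _ _⟩, ⟨⟨hwt, fun u hu => ?_⟩,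
    fun h => hne ?_⟩, hmem, ?_⟩, ?_⟩
  · rw [hpair u hu.1]
    refine integral_nonneg_of_ae ?_
    filter_upwards [hY, hu.2] with ω h1 h2
    exact Finset.sum_nonneg fun i _ => mul_nonneg (h1 i) (h2 i)
  · rw [← hpair v hv]; exact h.2 v hv
  · filter_upwards [hdd, hY] with ω h1 h2
    simp only [h1]; exact h2
  · refine Lp.ext ?_
    exact (dualVec_coe (z := (Q, w)) hmem).trans hdd

end DualVec

/-! ### Elementary facts on `cl`. -/

section Closure

variable {Ω : Type*} [m0 : MeasurableSpace Ω] {d : ℕ} {p : ℝ≥0∞} {P : Measure Ω} [Fact (1 ≤ p)]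
  {S C : Set (RV d p P)}

lemma subset_cl : S ⊆ cl S := @subset_closure _ (topo d p P) S

lemma isClosed_cl : @IsClosed _ (topo d p P) (cl S) := @isClosed_closure _ (topo d p P) S

lemma cl_subset (h : S ⊆ C) (hC : @IsClosed _ (topo d p P) C) : cl S ⊆ C :=
  @closure_minimal _ (topo d p P) _ _ h hC

end Closure

/-! ### The functionals of dual variables and separation by them. -/

section Evaluation

/-- An element of `L^q_d` that is nonnegative on the cone `L^p_d(𝓕_T)_+` is nonnegative. -/
lemma mem_posCone_of_pairing_nonneg {Ω : Type*} [MeasurableSpace Ω] {d : ℕ} {p q : ℝ≥0∞}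
    [Fact (1 ≤ q)] {P : Measure Ω} [IsFiniteMeasure P] {Y : RV d q P}
    (h : ∀ X ∈ posCone d p P, 0 ≤ pairing P Y X) : Y ∈ posCone d q P := by
  classical
  have hYm : Measurable Y := (Lp.stronglyMeasurable Y).measurable
  refine ae_all_iff.2 fun i => ?_
  have hYi : Measurable fun ω => Y ω i := (measurable_pi_apply i).comp hYm
  set A := {ω | Y ω i < 0}
  have hA : MeasurableSet A := measurableSet_lt hYi measurable_const
  set f : Ω → Fin d → ℝ := fun ω j => if j = i then A.indicator (fun _ => (1 : ℝ)) ω else 0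
  have hf : MemLp f p P := memLp_pi_iff.2 fun j => by
    by_cases hj : j = i
    · simp only [f, hj, if_true]
      exact memLp_indicator_const _ hA _ (Or.inr (measure_ne_top _ _))
    · simp [f, hj]
  have h1 := h hf.toLp (by
    filter_upwards [hf.coeFn_toLp] with ω h j
    rw [h]
    by_cases hj : j = i
    · simp only [f, hj, if_true]
      exact Set.indicator_nonneg (fun _ _ => zero_le_one) ω
    · simp [f, hj])
  rw [pairing_congr (Filter.EventuallyEq.refl _ _) hf.coeFn_toLp] at h1
  have h2 : pairing P Y f = ∫ ω in A, Y ω i ∂P := by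
    rw [← integral_indicator hA]
    refine integral_congr_ae (Filter.Eventually.of_forall fun ω => ?_)
    simp only [f, dotProduct, mul_ite, mul_zero, Finset.sum_ite_eq', Finset.mem_univ, if_true]
    by_cases hω : ω ∈ A <;> simp [hω]
  have hint : Integrable (fun ω => Y ω i) P :=
    (memLp_pi_iff.1 (Lp.memLp Y) i).integrable Fact.out
  have hneg : ∀ᵐ ω ∂P.restrict A, Y ω i ≤ 0 :=
    (ae_restrict_mem hA).mono fun ω hω => le_of_lt hω
  have h3 : (fun ω => -Y ω i) =ᵐ[P.restrict A] 0 := by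
    refine (integral_eq_zero_iff_of_nonneg_ae ?_ hint.neg.integrableOn).1 ?_
    · filter_upwards [hneg] with ω h
      simpa using h
    · simp only [Pi.neg_apply]
      rw [integral_neg, neg_eq_zero]
      exact le_antisymm (integral_nonpos_of_ae hneg) (h2 ▸ h1)
  filter_upwards [(ae_restrict_iff' hA).1 h3] with ω h
  by_contra hω
  have hω' : Y ω i < 0 := not_le.1 hω
  have := h hω'
  simp only [Pi.zero_apply, neg_eq_zero] at this
  exact hω this.ge

lemma pairing_nonneg {Ω : Type*} [MeasurableSpace Ω] {d : ℕ} {p q : ℝ≥0∞} {P : Measure Ω}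
    {Y : RV d q P} (hY : Y ∈ posCone d q P) {X : RV d p P}
    (hX : X ∈ posCone d p P) : 0 ≤ pairing P Y X := by
  refine integral_nonneg_of_ae ?_
  filter_upwards [hY, hX] with ω h1 h2
  exact Finset.sum_nonneg fun i _ => mul_nonneg (h1 i) (h2 i)

variable {Ω : Type*} [m0 : MeasurableSpace Ω] {d : ℕ} {p q : ℝ≥0∞} {P : Measure Ω}
  {𝓕 : Filtration ℕ m0} {T t : ℕ} [Fact (1 ≤ p)] [Fact (1 ≤ q)] [ENNReal.HolderConjugate p q]
  {M : Submodule ℝ (RV d p P)} {z : (Fin d → Measure Ω) × RV d q P}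

variable (p 𝓕 T t) in
/-- The functional `X ↦ E[dualDensityᵀ X]`. -/
def dualEval (z : (Fin d → Measure Ω) × RV d q P) : RV d p P →L[ℝ] ℝ :=
  pair d p q P (dualVec 𝓕 T t z)

lemma dualEval_apply (z : (Fin d → Measure Ω) × RV d q P) (X : RV d p P) :
    dualEval p 𝓕 T t z X = pairing P (dualVec 𝓕 T t z) X := pair_apply _ _

lemma continuous_dualEval (z : (Fin d → Measure Ω) × RV d q P) :
    @Continuous _ _ (topo d p P) _ (dualEval p 𝓕 T t z) := by
  have : (dualEval p 𝓕 T t z : RV d p P → ℝ) = fun X : RV d p P =>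
      pairing P (dualVec 𝓕 T t z) X :=
    funext fun X => dualEval_apply z X
  rw [this]
  exact continuous_pair _

lemma dualEval_nonneg (hz : z ∈ dualVars 𝓕 T t q (M : Set (RV d p P))) {X : RV d p P}
    (hX : X ∈ posCone d p P) : 0 ≤ dualEval p 𝓕 T t z X := by
  rw [dualEval_apply]
  exact pairing_nonneg (dualVec_mem_posCone hz) hX

variable [IsFiniteMeasure P]

lemma mem_halfspace (htT : t ≤ T) (hz : z ∈ dualVars 𝓕 T t q (M : Set (RV d p P))) {x : RV d p P} :
    x ∈ halfspace (𝓕 t) p z.2 ↔ x ∈ LpAt (𝓕 t) d p P ∧ 0 ≤ dualEval p 𝓕 T t z x := by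
  refine and_congr_right fun hx => ?_
  rw [dualEval_apply, pairing_dualVec_of_mem_LpAt htT hz hx]

variable (hM : IsEligible (𝓕 t) M) (htT : t ≤ T)
include hM

lemma dualEval_lmul {l : Lp ℝ ∞ P} (hl : l ∈ LInf (𝓕 t) P)
    (hpos : ∀ᵐ ω ∂P, 0 < l ω) (hz : z ∈ dualVars 𝓕 T t q (M : Set (RV d p P))) (X : RV d p P) :
    dualEval p 𝓕 T t (z.1, lmul l z.2) X = dualEval p 𝓕 T t z (lmul l X) := by
  rw [dualEval_apply, (lmul_mem_dualVars hM hl hpos hz).2, pairing_lmul, ← dualEval_apply]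

include htT

lemma mem_dualFun (hz : z ∈ dualVars 𝓕 T t q (M : Set (RV d p P))) {X u : RV d p P} :
    u ∈ dualFun 𝓕 T t (M : Set (RV d p P)) z X ↔
      u ∈ M ∧ dualEval p 𝓕 T t z X ≤ dualEval p 𝓕 T t z u := by
  rw [dualFun_eq hM htT hz, dualEval_apply, dualEval_apply]
  rfl

lemma exists_dualEval_pos (hz : z ∈ dualVars 𝓕 T t q (M : Set (RV d p P))) :
    ∃ v ∈ M, 0 < dualEval p 𝓕 T t z v := by
  simp_rw [dualEval_apply]
  exact exists_pairing_dualVec_pos hM htT hz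

lemma exists_dualEval_eq (hz : z ∈ dualVars 𝓕 T t q (M : Set (RV d p P))) (c : ℝ) :
    ∃ v ∈ M, dualEval p 𝓕 T t z v = c := by
  obtain ⟨v, hv, h⟩ := exists_dualEval_pos hM htT hz
  exact ⟨(c / dualEval p 𝓕 T t z v) • v, M.smul_mem _ hv, by
    rw [map_smul, smul_eq_mul, div_mul_cancel₀ _ h.ne']⟩

/-- Separation of a point from a closed convex monotone set by a dual variable. -/
lemma exists_dualVar_separating [IsProbabilityMeasure P] (h𝓕T : 𝓕 T = m0)
    {A : Set (RV d p P)} (hA : Convex ℝ A)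
    (hAc : @IsClosed _ (topo d p P) A) (hmono : ∀ X ∈ A, ∀ K ∈ posCone d p P, X + K ∈ A)
    {m u : RV d p P} (hm : m ∈ M) (hmA : m ∈ A) (hu : u ∈ M) (huA : u ∉ A)
    {X : RV d p P} (hX : X ∉ A) :
    ∃ z ∈ dualVars 𝓕 T t q (M : Set (RV d p P)), ∃ c : ℝ, dualEval p 𝓕 T t z X < c ∧
      ∀ Z ∈ A, c ≤ dualEval p 𝓕 T t z Z := by
  -- A functional bounded below on `A` is nonnegative: otherwise it would tend to `-∞` along a ray
  -- `m + r K` inside `A`.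
  have hpos : ∀ (Y : RV d q P) (c : ℝ), (∀ Z ∈ A, c ≤ pairing P Y Z) → Y ∈ posCone d q P := by
    intro Y c hc
    refine mem_posCone_of_pairing_nonneg (p := p) fun K hK => ?_
    by_contra hneg
    rw [not_le] at hneg
    have hs : ∀ r : ℝ, 0 ≤ r → c ≤ pairing P Y m + r * pairing P Y K := by
      intro r hr
      have h1 := hc _ (hmono m hmA (r • K) (by
        filter_upwards [hK, Lp.coeFn_smul r K] with ω h1 h2 i
        rw [h2]; exact mul_nonneg hr (h1 i)))
      rwa [← pair_apply, map_add, map_smul, smul_eq_mul, pair_apply, pair_apply] at h1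
    have h0 := hs 0 le_rfl
    -- This `r` makes the value at `m + r K` equal to `c - 1`; it is nonnegative because numerator
    -- and denominator are both negative or zero.
    have h1 := hs ((c - pairing P Y m - 1) / pairing P Y K)
      (div_nonneg_of_nonpos (by linarith) hneg.le)
    rw [div_mul_cancel₀ _ hneg.ne] at h1
    linarith
  have hfin : ∀ (Y : RV d q P) (c : ℝ), (∀ Z ∈ A, c ≤ pairing P Y Z) → pairing P Y X < c →
      (∃ v ∈ M, pairing P Y v ≠ 0) → ∃ z ∈ dualVars 𝓕 T t q (M : Set (RV d p P)), ∃ c : ℝ,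
        dualEval p 𝓕 T t z X < c ∧ ∀ Z ∈ A, c ≤ dualEval p 𝓕 T t z Z := by
    rintro Y c hc hlt ⟨v, hv, hne⟩
    obtain ⟨z, hz, rfl⟩ := exists_dualVar hM h𝓕T htT (hpos Y c hc) hv hne
    exact ⟨z, hz, c, by rwa [dualEval_apply], fun Z hZ => by rw [dualEval_apply]; exact hc Z hZ⟩
  obtain ⟨Y, c, hYX, hY⟩ := exists_separating (q := q) hA hAc hX
  by_cases hYM : ∃ v ∈ M, pairing P Y v ≠ 0
  · exact hfin Y c hY hYX hYM
  simp only [not_exists, not_and, not_not] at hYM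
  -- If `Y` vanishes on `M`, it is corrected by a functional `Y₀` separating `u` from `A`. As `m ∈
  -- A` and `u ∉ A` both lie in `M`, this `Y₀` cannot vanish on `M`.
  obtain ⟨Y₀, c₀, hY₀u, hY₀⟩ := exists_separating (q := q) hA hAc huA
  have hY₀M : ∃ v ∈ M, pairing P Y₀ v ≠ 0 := by
    by_contra h
    simp only [not_exists, not_and, not_not] at h
    have h1 := hY₀ m hmA
    rw [h m hm] at h1
    rw [h u hu] at hY₀u
    linarith
  obtain ⟨v, hv, hne⟩ := hY₀M
  obtain ⟨ε, hε, hε'⟩ : ∃ ε : ℝ, 0 < ε ∧ pairing P Y X + ε * pairing P Y₀ X < c + ε * c₀ := by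
    -- The perturbation uses at most half of the gap `c - ⟨Y, X⟩`; the added 1 keeps the denominator
    -- positive.
    refine ⟨(c - pairing P Y X) / (2 * (|pairing P Y₀ X - c₀| + 1)),
      div_pos (by linarith) (by positivity), ?_⟩
    set e := (c - pairing P Y X) / (2 * (|pairing P Y₀ X - c₀| + 1)) with he
    have he0 : 0 < e := div_pos (by linarith) (by positivity)
    have h1 : e * (|pairing P Y₀ X - c₀| + 1) = (c - pairing P Y X) / 2 := by
      rw [he]; field_simp
    have h2 : e * (pairing P Y₀ X - c₀) ≤ e * (|pairing P Y₀ X - c₀| + 1) :=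
      mul_le_mul_of_nonneg_left (by linarith [le_abs_self (pairing P Y₀ X - c₀)]) he0.le
    nlinarith
  have hcomb : ∀ Z : RV d p P,
      pairing P (Y + ε • Y₀ : RV d q P) Z = pairing P Y Z + ε * pairing P Y₀ Z := by
    intro Z
    simp only [← pair_apply, map_add, map_smul]
    rfl
  refine hfin (Y + ε • Y₀) (c + ε * c₀) (fun Z hZ => ?_) ?_ ⟨v, hv, ?_⟩
  · rw [hcomb]
    exact add_le_add (hY Z hZ) (mul_le_mul_of_nonneg_left (hY₀ Z hZ) hε.le)
  · rw [hcomb]; exact hε'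
  · rw [hcomb, hYM v hv, zero_add]
    exact mul_ne_zero hε.ne' hne

end Evaluation

/-! ### Penalty values as subsets of `M` given by lower bounds on a functional. -/

section BoundSets

variable {Ω : Type*} [m0 : MeasurableSpace Ω] {d : ℕ} {p q : ℝ≥0∞} {P : Measure Ω}
  {𝓕 : Filtration ℕ m0} {T t : ℕ} [Fact (1 ≤ p)] [Fact (1 ≤ q)] [ENNReal.HolderConjugate p q]
  {M : Submodule ℝ (RV d p P)} {z : (Fin d → Measure Ω) × RV d q P} {B : Set ℝ}

variable (𝓕 T t M) in
/-- The part of `M` on which the functional of `z` exceeds every element of `B`. -/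
def boundSet (z : (Fin d → Measure Ω) × RV d q P) (B : Set ℝ) : Set (RV d p P) :=
  {u | u ∈ M ∧ ∀ b ∈ B, b ≤ dualEval p 𝓕 T t z u}

lemma isClosed_forall_le_dualEval (z : (Fin d → Measure Ω) × RV d q P) (B : Set ℝ) :
    @IsClosed _ (topo d p P) {u : RV d p P | ∀ b ∈ B, b ≤ dualEval p 𝓕 T t z u} := by
  have : {u : RV d p P | ∀ b ∈ B, b ≤ dualEval p 𝓕 T t z u} =
      ⋂ b ∈ B, dualEval p 𝓕 T t z ⁻¹' Set.Ici b := by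
    ext u; simp
  rw [this]
  exact @isClosed_iInter _ _ (topo d p P) _ fun b => @isClosed_iInter _ _ (topo d p P) _ fun _ =>
    @IsClosed.preimage _ _ (topo d p P) _ _ (continuous_dualEval z) _ isClosed_Ici

lemma isClosed_boundSet (hM : IsEligible (𝓕 t) M) : @IsClosed _ (topo d p P) (boundSet 𝓕 T t M z B) :=
  @IsClosed.inter _ _ _ (topo d p P) hM.isClosed (isClosed_forall_le_dualEval z B)

lemma boundSet_mem_closedConvexUpperSets (hM : IsEligible (𝓕 t) M)
    (hz : z ∈ dualVars 𝓕 T t q (M : Set (RV d p P))) :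
    boundSet 𝓕 T t M z B ∈ closedConvexUpperSets (M : Set (RV d p P)) := by
  have hconv : Convex ℝ (boundSet 𝓕 T t M z B) := by
    refine M.convex.inter ?_
    intro x hx y hy a b ha hb hab c hc
    rw [map_add, map_smul, map_smul, smul_eq_mul, smul_eq_mul]
    have h1 := mul_le_mul_of_nonneg_left (hx c hc) ha
    have h2 := mul_le_mul_of_nonneg_left (hy c hc) hb
    have h3 : a * c + b * c = c := by rw [← add_mul, hab, one_mul]
    linarith
  have hadd : boundSet 𝓕 T t M z B + nonneg (M : Set (RV d p P)) ⊆ boundSet 𝓕 T t M z B := by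
    rintro _ ⟨x, hx, k, hk, rfl⟩
    refine ⟨M.add_mem hx.1 hk.1, fun b hb => ?_⟩
    rw [map_add]
    linarith [hx.2 b hb, dualEval_nonneg hz hk.2]
  refine ⟨fun u hu => hu.1, Set.Subset.antisymm (fun u hu => ?_) ?_⟩
  · refine subset_cl (subset_convexHull ℝ _ ⟨u, hu, 0, ⟨M.zero_mem, ?_⟩, add_zero u⟩)
    filter_upwards [Lp.coeFn_zero (Fin d → ℝ) p P] with ω h i
    rw [h]; rfl
  · exact cl_subset (convexHull_min hadd hconv) (isClosed_boundSet hM)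

variable [IsFiniteMeasure P] (hM : IsEligible (𝓕 t) M) (htT : t ≤ T)
include hM htT

lemma boundSet_eq_cl (hz : z ∈ dualVars 𝓕 T t q (M : Set (RV d p P))) :
    boundSet 𝓕 T t M z B =
      cl (boundSet 𝓕 T t M z B + halfspace (𝓕 t) p z.2) ∩ (M : Set (RV d p P)) := by
  refine Set.Subset.antisymm (fun u hu => ⟨subset_cl ⟨u, hu, 0, ?_, add_zero u⟩, hu.1⟩) ?_
  · exact (mem_halfspace htT hz).2 ⟨hM.mem_LpAt _ M.zero_mem, by rw [map_zero]⟩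
  · rintro u ⟨hu, huM⟩
    refine ⟨huM, ?_⟩
    refine cl_subset ?_ (isClosed_forall_le_dualEval z B) hu
    rintro _ ⟨x, hx, k, hk, rfl⟩ b hb
    rw [map_add]
    linarith [hx.2 b hb, ((mem_halfspace htT hz).1 hk).2]

/-- A dual functional maps `M` onto `ℝ`, so some `v ∈ M` has the same value as `X`; shifting by `v`
moves the bound from `u` to `X + u`. -/
lemma boundSet_add_dualFun (hz : z ∈ dualVars 𝓕 T t q (M : Set (RV d p P))) (X : RV d p P) :
    boundSet 𝓕 T t M z B + dualFun 𝓕 T t (M : Set (RV d p P)) z (-X) =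
      {u | u ∈ M ∧ ∀ b ∈ B, b ≤ dualEval p 𝓕 T t z (X + u)} := by
  ext u
  constructor
  · rintro ⟨x, hx, y, hy, rfl⟩
    rw [mem_dualFun hM htT hz, map_neg] at hy
    refine ⟨M.add_mem hx.1 hy.1, fun b hb => ?_⟩
    rw [map_add, map_add]
    linarith [hx.2 b hb, hy.2]
  · rintro ⟨hu, hb⟩
    obtain ⟨v, hv, hvX⟩ := exists_dualEval_eq hM htT hz (dualEval p 𝓕 T t z X)
    refine ⟨u + v, ⟨M.add_mem hu hv, fun b hbB => ?_⟩, -v, ?_, add_neg_cancel_right u v⟩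
    · rw [map_add, hvX, add_comm, ← map_add]
      exact hb b hbB
    · rw [mem_dualFun hM htT hz, map_neg, map_neg, hvX]
      exact ⟨M.neg_mem hv, le_rfl⟩

/-- Bounds are kept as sets of lower bounds, so infima equal to `±∞` need no separate treatment. -/
lemma boundSet_subset_of_approx (hz : z ∈ dualVars 𝓕 T t q (M : Set (RV d p P)))
    {A D : Set (RV d p P)} (hDc : @IsClosed _ (topo d p P) D)
    (hD : ∀ u ∈ M, (∃ Z ∈ A, dualEval p 𝓕 T t z Z ≤ dualEval p 𝓕 T t z u) → u ∈ D) :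
    boundSet 𝓕 T t M z (lowerBounds (dualEval p 𝓕 T t z '' A)) ⊆ D := by
  rintro u ⟨hu, hub⟩
  -- The infimum over `A` need not be attained. Moving `u` slightly in a direction of increase puts
  -- it above some element of `A`; otherwise its new value would itself be a lower bound of `A` and
  -- thus at most the value at `u`.
  obtain ⟨v, hv, hpos⟩ := exists_dualEval_pos hM htT hz
  refine mem_of_forall_add_smul_mem hDc (v := v) fun ε hε _ => ?_
  refine hD _ (M.add_mem hu (M.smul_mem _ hv)) ?_
  by_contra hcon
  simp only [not_exists, not_and, not_le] at hcon
  have := hub (dualEval p 𝓕 T t z (u + ε • v)) (by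
    rintro _ ⟨Z, hZ, rfl⟩
    exact (hcon Z hZ).le)
  rw [map_add, map_smul, smul_eq_mul] at this
  linarith [mul_pos hε hpos]

lemma minPenalty_eq (hz : z ∈ dualVars 𝓕 T t q (M : Set (RV d p P)))
    (R : RV d p P → Set (RV d p P)) :
    minPenalty 𝓕 T t (M : Set (RV d p P)) R z =
      boundSet 𝓕 T t M z (lowerBounds (dualEval p 𝓕 T t z '' acceptance R)) := by
  refine Set.Subset.antisymm (cl_subset ?_ (isClosed_boundSet hM)) ?_
  · refine Set.iUnion₂_subset fun Z hZ u hu => ?_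
    rw [mem_dualFun hM htT hz] at hu
    exact ⟨hu.1, fun b hb => (hb ⟨Z, hZ, rfl⟩).trans hu.2⟩
  · refine boundSet_subset_of_approx hM htT hz isClosed_cl ?_
    rintro u hu ⟨Z, hZ, hle⟩
    refine subset_cl (Set.mem_iUnion₂.2 ⟨Z, hZ, ?_⟩)
    rw [mem_dualFun hM htT hz]
    exact ⟨hu, hle⟩

/-- The closure identity says that `D` is closed upwards in `M` with respect to the functional of
`z`; being closed as well, it is determined by the infimum of that functional. -/
lemma penalty_eq_boundSet (hz : z ∈ dualVars 𝓕 T t q (M : Set (RV d p P))) {D : Set (RV d p P)}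
    (hD : D ∈ closedConvexUpperSets (M : Set (RV d p P)))
    (hDcl : D = cl (D + halfspace (𝓕 t) p z.2) ∩ (M : Set (RV d p P))) :
    D = boundSet 𝓕 T t M z (lowerBounds (dualEval p 𝓕 T t z '' D)) := by
  refine Set.Subset.antisymm (fun u hu => ⟨hD.1 hu, fun b hb => hb ⟨u, hu, rfl⟩⟩) ?_
  refine boundSet_subset_of_approx hM htT hz (hD.2 ▸ isClosed_cl) ?_
  rintro u hu ⟨x, hx, hle⟩
  rw [hDcl]
  refine ⟨subset_cl ⟨x, hx, u - x, ?_, add_sub_cancel x u⟩, hu⟩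
  refine (mem_halfspace htT hz).2 ⟨hM.mem_LpAt _ (M.sub_mem hu (hD.1 hx)), ?_⟩
  rw [map_sub]; linarith

end BoundSets

/-! ### Risk measures through their acceptance sets. -/

section RiskMeasure

variable {Ω : Type*} [m0 : MeasurableSpace Ω] {d : ℕ} {p : ℝ≥0∞} {P : Measure Ω}
  {M : Submodule ℝ (RV d p P)} {R : RV d p P → Set (RV d p P)}

lemma zero_mem_nonneg : (0 : RV d p P) ∈ nonneg (M : Set (RV d p P)) := by
  refine ⟨M.zero_mem, ?_⟩
  filter_upwards [Lp.coeFn_zero (Fin d → ℝ) p P] with ω h i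
  rw [h]; rfl

lemma IsCondRiskMeasure.mem_iff (hR : IsCondRiskMeasure (M : Set (RV d p P)) R)
    {X u : RV d p P} : u ∈ R X ↔ u ∈ M ∧ X + u ∈ acceptance R := by
  constructor
  · intro hu
    have huM : u ∈ M := (hR.mem_upperSets X).1 hu
    refine ⟨huM, ?_⟩
    change (0 : RV d p P) ∈ R (X + u)
    rw [hR.translative X u huM]
    exact ⟨u, hu, sub_self u⟩
  · rintro ⟨huM, hu⟩
    change (0 : RV d p P) ∈ R (X + u) at hu
    rw [hR.translative X u huM] at hu
    obtain ⟨v, hv, hvu⟩ := hu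
    rwa [← sub_eq_zero.1 hvu]

lemma IsCondRiskMeasure.acceptance_add_mem (hR : IsCondRiskMeasure (M : Set (RV d p P)) R) :
    ∀ X ∈ acceptance R, ∀ K ∈ posCone d p P, X + K ∈ acceptance R := fun X hX K hK =>
  hR.monotone X (X + K) (by rwa [add_sub_cancel_left]) hX

lemma IsCondRiskMeasure.exists_mem_acceptance (hR : IsCondRiskMeasure (M : Set (RV d p P)) R) :
    ∃ m ∈ M, m ∈ acceptance R := by
  obtain ⟨m, hm⟩ := Set.nonempty_iff_ne_empty.2 hR.nonempty_zero
  have := hR.mem_iff.1 hm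
  rw [zero_add] at this
  exact ⟨m, this⟩

lemma IsCondRiskMeasure.exists_notMem_acceptance (hR : IsCondRiskMeasure (M : Set (RV d p P)) R) :
    ∃ u ∈ M, u ∉ acceptance R := by
  by_contra h
  simp only [not_exists, not_and, not_not] at h
  refine hR.zero_ne (Set.Subset.antisymm (hR.mem_upperSets 0).1 fun u hu => ?_)
  exact hR.mem_iff.2 ⟨hu, by rw [zero_add]; exact h u hu⟩

variable [Fact (1 ≤ p)]

lemma mem_upperSets_of_mem_closedConvexUpperSets {D : Set (RV d p P)}
    (hD : D ∈ closedConvexUpperSets (M : Set (RV d p P))) :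
    D ∈ upperSets (M : Set (RV d p P)) := by
  refine ⟨hD.1, Set.Subset.antisymm (fun u hu => ⟨u, hu, 0, zero_mem_nonneg, add_zero u⟩) ?_⟩
  nth_rewrite 2 [hD.2]
  exact (subset_convexHull ℝ _).trans subset_cl

lemma isClosed_acceptance (hc : HasClosedGraph (M : Set (RV d p P)) R) :
    @IsClosed _ (topo d p P) (acceptance R) := by
  have h1 : @Continuous _ _ (topo d p P)
      (@instTopologicalSpaceProd _ _ (topo d p P) (topo d p P))
      (fun X : RV d p P => (X, (0 : RV d p P))) :=
    @Continuous.prodMk _ _ _ (topo d p P) (topo d p P) (topo d p P) _ _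
      (@continuous_id _ (topo d p P)) (@continuous_const _ _ (topo d p P) (topo d p P) _)
  have h2 := @IsClosed.preimage _ _ (topo d p P)
    (@instTopologicalSpaceProd _ _ (topo d p P) (topo d p P)) _ h1 _ hc
  have h3 : acceptance R = (fun X : RV d p P => (X, (0 : RV d p P))) ⁻¹'
      {z | z.2 ∈ (M : Set (RV d p P)) ∧ z.2 ∈ R z.1} := by
    ext X
    exact ⟨fun h => ⟨M.zero_mem, h⟩, fun h => h.2⟩
  rw [h3]
  exact h2

end RiskMeasure

/-- Stated for an abstract space so that it can be applied to `topo`, which is not the instance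
topology of `RV`. -/
lemma isClosed_le_add_prod {E : Type*} [TopologicalSpace E] {f : E → ℝ} (hf : Continuous f)
    (b : ℝ) : IsClosed {y : E × E | b ≤ f y.1 + f y.2} :=
  isClosed_le continuous_const ((hf.comp continuous_fst).add (hf.comp continuous_snd))

lemma isClosed_snd_mem {E : Type*} [TopologicalSpace E] {S : Set E} (hS : IsClosed S) :
    IsClosed {y : E × E | y.2 ∈ S} := hS.preimage continuous_snd

lemma le_of_forall_small_le {a b c : ℝ} (h : ∀ ε : ℝ, 0 < ε → ε < 1 → b ≤ a + ε * c) : b ≤ a := by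
  have hc : Filter.Tendsto (fun ε : ℝ => a + ε * c) (nhdsWithin 0 (Set.Ioi 0)) (nhds a) := by
    have : Continuous fun ε : ℝ => a + ε * c := by fun_prop
    simpa using (this.tendsto 0).mono_left nhdsWithin_le_nhds
  refine ge_of_tendsto hc ?_
  filter_upwards [Ioo_mem_nhdsGT (show (0 : ℝ) < 1 from one_pos)] with ε hε
  exact h ε hε.1 hε.2

/-! ### Membership and inversion in `L^∞(𝓕_t)`. -/

section Scalars

variable {Ω : Type*} {𝓕t : MeasurableSpace Ω} [m0 : MeasurableSpace Ω] {d : ℕ} {p : ℝ≥0∞}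
  {P : Measure Ω}

lemma lmul_zero (l : Lp ℝ ∞ P) : lmul l (0 : RV d p P) = 0 := by
  have h := lmul_add l (0 : RV d p P) 0
  rw [add_zero] at h
  exact left_eq_add.1 h

lemma add_mem_LInf {l k : Lp ℝ ∞ P} (hl : l ∈ LInf 𝓕t P) (hk : k ∈ LInf 𝓕t P) :
    l + k ∈ LInf 𝓕t P :=
  (AEStronglyMeasurable.add (f := l) (g := k) hl hk).congr (Lp.coeFn_add l k).symm

lemma smul_mem_LInf {l : Lp ℝ ∞ P} (hl : l ∈ LInf 𝓕t P) (c : ℝ) : c • l ∈ LInf 𝓕t P :=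
  (AEStronglyMeasurable.const_smul hl c).congr (Lp.coeFn_smul c l).symm

lemma LInfPos_pos {l : Lp ℝ ∞ P} (hl : l ∈ LInfPos 𝓕t P) : ∀ᵐ ω ∂P, 0 < l ω := by
  obtain ⟨-, ε, hε, h⟩ := hl
  filter_upwards [h] with ω h
  exact hε.trans_le h

variable [IsFiniteMeasure P]

lemma const_mem_LInf (c : ℝ) : Lp.const ∞ P c ∈ LInf 𝓕t P :=
  AEStronglyMeasurable.congr (f := fun _ => c) aestronglyMeasurable_const
    (Lp.coeFn_const (p := ∞) (μ := P) c).symm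

lemma oneSub_mem_LInf {l : Lp ℝ ∞ P} (hl : l ∈ LInf 𝓕t P) : oneSub l ∈ LInf 𝓕t P :=
  (AEStronglyMeasurable.sub (f := fun _ => (1 : ℝ)) aestronglyMeasurable_const hl).congr
    (oneSub_coe l).symm

lemma const_mem_LInfPos {c : ℝ} (hc : 0 < c) : Lp.const ∞ P c ∈ LInfPos 𝓕t P := by
  refine ⟨const_mem_LInf c, c, hc, ?_⟩
  filter_upwards [Lp.coeFn_const (p := ∞) (μ := P) c] with ω h
  rw [h]; exact le_rfl

/-- Elements of `L^∞(𝓕_t)_{++}` are invertible there. -/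
lemma exists_LInfPos_inv (h𝓕 : 𝓕t ≤ m0) {l : Lp ℝ ∞ P} (hl : l ∈ LInfPos 𝓕t P) :
    ∃ k ∈ LInfPos 𝓕t P, (∀ X : RV d p P, lmul k (lmul l X) = X) ∧
      ∀ X : RV d p P, lmul l (lmul k X) = X := by
  obtain ⟨hlm, ε, hε, hle⟩ := hl
  obtain ⟨g, hg, hlg⟩ := hlm
  -- The maximum with `ε` changes `g` only on a null set and bounds the reciprocal everywhere by
  -- `ε⁻¹`.
  obtain ⟨k, hk, hkeq⟩ := exists_LInf (P := P) h𝓕 (f := fun ω => (max ε (g ω))⁻¹) (B := ε⁻¹)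
    (Measurable.max measurable_const hg.measurable).inv (fun ω => by
      rw [abs_of_nonneg (inv_nonneg.2 (hε.le.trans (le_max_left _ _)))]
      exact inv_anti₀ hε (le_max_left _ _))
  have hinv : ∀ᵐ ω ∂P, k ω * l ω = 1 ∧ 0 < l ω := by
    filter_upwards [hkeq, hlg, hle] with ω h1 h2 h3
    rw [h1, ← h2, max_eq_right h3]
    exact ⟨inv_mul_cancel₀ (hε.trans_le h3).ne', hε.trans_le h3⟩
  refine ⟨k, ⟨hk, (‖l‖ + 1)⁻¹, by positivity, ?_⟩, fun X => Lp.ext ?_, fun X => Lp.ext ?_⟩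
  · have hb : ∀ᵐ ω ∂P, ‖l ω‖ ≤ ‖l‖ := by
      have := ae_le_eLpNormEssSup (f := l) (μ := P)
      filter_upwards [this] with ω h
      rw [Lp.norm_def, ← toReal_enorm]
      exact ENNReal.toReal_mono (Lp.eLpNorm_ne_top l) (by rwa [eLpNorm_exponent_top])
    filter_upwards [hinv, hb] with ω h1 h2
    rw [← inv_inv (k ω), ← eq_inv_of_mul_eq_one_right h1.1]
    refine inv_anti₀ h1.2 ?_
    linarith [le_abs_self (l ω), (Real.norm_eq_abs (l ω)) ▸ h2]
  · filter_upwards [hinv, lmul_coe k (lmul l X), lmul_coe l X] with ω h1 h2 h3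
    rw [h2, h3, smul_smul, h1.1, one_smul]
  · filter_upwards [hinv, lmul_coe l (lmul k X), lmul_coe k X] with ω h1 h2 h3
    rw [h2, h3, smul_smul, mul_comm, h1.1, one_smul]

end Scalars

/-! ### Closed risk measures defined by bounds on dual functionals. -/

section Form

variable {Ω : Type*} [m0 : MeasurableSpace Ω] {d : ℕ} {p q : ℝ≥0∞} {P : Measure Ω}
  {𝓕 : Filtration ℕ m0} {T t : ℕ} [Fact (1 ≤ p)] [Fact (1 ≤ q)] [ENNReal.HolderConjugate p q]
  {M : Submodule ℝ (RV d p P)} {R : RV d p P → Set (RV d p P)}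

/-- A set-valued map given by lower bounds on dual functionals is a closed risk measure as soon as
its value at `0` is nontrivial. -/
lemma isCondRiskMeasure_of_bounds (hM : IsEligible (𝓕 t) M)
    {W : Set ((Fin d → Measure Ω) × RV d q P)} (hW : W ⊆ dualVars 𝓕 T t q (M : Set (RV d p P)))
    {B : (Fin d → Measure Ω) × RV d q P → Set ℝ}
    (hform : ∀ X u, u ∈ R X ↔ u ∈ M ∧ ∀ z ∈ W, ∀ b ∈ B z, b ≤ dualEval p 𝓕 T t z (X + u))
    (hup : ∀ X, R X ∈ closedConvexUpperSets (M : Set (RV d p P))) (h0 : R 0 ≠ ∅) (h1 : R 0 ≠ M) :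
    IsCondRiskMeasure (M : Set (RV d p P)) R ∧ HasClosedGraph (M : Set (RV d p P)) R := by
  refine ⟨⟨fun X => mem_upperSets_of_mem_closedConvexUpperSets (hup X), fun X m hm => ?_,
    fun X Y hXY u hu => ?_, h0, h1⟩, ?_⟩
  · ext u
    constructor
    · intro hu
      rw [hform] at hu
      refine ⟨u + m, (hform _ _).2 ⟨M.add_mem hu.1 hm, fun z hz b hb => ?_⟩, add_sub_cancel_right u m⟩
      rw [add_comm u m, ← add_assoc]
      exact hu.2 z hz b hb
    · rintro ⟨v, hv, rfl⟩
      rw [hform] at hv ⊢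
      refine ⟨M.sub_mem hv.1 hm, fun z hz b hb => ?_⟩
      rw [add_assoc, add_sub_cancel]
      exact hv.2 z hz b hb
  · rw [hform] at hu ⊢
    refine ⟨hu.1, fun z hz b hb => (hu.2 z hz b hb).trans ?_⟩
    have := dualEval_nonneg (hW hz) hXY
    rw [map_sub] at this
    rw [map_add, map_add]
    linarith
  · have hset : {y : RV d p P × RV d p P | y.2 ∈ (M : Set (RV d p P)) ∧ y.2 ∈ R y.1} =
        {y | y.2 ∈ (M : Set (RV d p P))} ∩
          ⋂ z ∈ W, ⋂ b ∈ B z, {y | b ≤ dualEval p 𝓕 T t z y.1 + dualEval p 𝓕 T t z y.2} := by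
      ext y
      simp only [Set.mem_inter_iff, Set.mem_iInter, Set.mem_ofPred_eq, hform, map_add,
        SetLike.mem_coe, and_self_left]
    rw [HasClosedGraph, hset]
    refine @IsClosed.inter _ _ _ (_) (@isClosed_snd_mem _ (topo d p P) _ hM.isClosed) ?_
    exact @isClosed_iInter _ _ (_) _ fun z => @isClosed_iInter _ _ (_) _ fun _ =>
      @isClosed_iInter _ _ (_) _ fun b => @isClosed_iInter _ _ (_) _ fun _ =>
        @isClosed_le_add_prod _ (topo d p P) _ (continuous_dualEval z) b

end Form

/-! ### Convexity and conicity of the acceptance set. -/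

section Acceptance

variable {Ω : Type*} {𝓕t : MeasurableSpace Ω} [m0 : MeasurableSpace Ω] {d : ℕ} {p : ℝ≥0∞}
  {P : Measure Ω} {R : RV d p P → Set (RV d p P)}

lemma IsCondPosHomogeneous.lmul_acceptance_mem (hR : IsCondPosHomogeneous 𝓕t R) {X : RV d p P}
    (hX : X ∈ acceptance R) {l : Lp ℝ ∞ P} (hl : l ∈ LInfPos 𝓕t P) :
    lmul l X ∈ acceptance R := by
  change (0 : RV d p P) ∈ R (lmul l X)
  rw [hR X l hl]
  exact ⟨0, hX, lmul_zero l⟩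

variable [IsFiniteMeasure P]

lemma IsCondConvex.acceptance_mem (hR : IsCondConvex 𝓕t R) {X Y : RV d p P}
    (hX : X ∈ acceptance R) (hY : Y ∈ acceptance R) {l : Lp ℝ ∞ P} (hl : l ∈ LInf 𝓕t P)
    (hl01 : ∀ᵐ ω ∂P, 0 ≤ l ω ∧ l ω ≤ 1) : lmul l X + lmul (oneSub l) Y ∈ acceptance R :=
  hR X Y l hl hl01 ⟨0, ⟨0, hX, lmul_zero l⟩, 0, ⟨0, hY, lmul_zero _⟩, add_zero 0⟩

lemma IsCondConvex.convex_acceptance (hR : IsCondConvex 𝓕t R) : Convex ℝ (acceptance R) := by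
  intro X hX Y hY a b ha hb hab
  have h := hR.acceptance_mem hX hY (const_mem_LInf a) (by
    filter_upwards [Lp.coeFn_const (p := ∞) (μ := P) a] with ω h
    rw [h]
    exact ⟨ha, by simpa using by linarith⟩)
  rw [oneSub_lmul, lmul_const, lmul_const] at h
  have hb' : b = 1 - a := by linarith
  rwa [hb', sub_smul, one_smul]

lemma IsCondPosHomogeneous.smul_acceptance_mem (hR : IsCondPosHomogeneous 𝓕t R) {X : RV d p P}
    (hX : X ∈ acceptance R) {c : ℝ} (hc : 0 < c) : c • X ∈ acceptance R := by
  rw [← lmul_const]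
  exact hR.lmul_acceptance_mem hX (const_mem_LInfPos hc)

lemma IsCondCoherent.isCondPosHomogeneous (hR : IsCondCoherent 𝓕t R) :
    IsCondPosHomogeneous 𝓕t R := hR.elim (fun h => h.2) fun h => h.2

lemma IsCondCoherent.convex_acceptance (hR : IsCondCoherent 𝓕t R) : Convex ℝ (acceptance R) := by
  rcases hR with ⟨h, -⟩ | ⟨hsub, hpos⟩
  · exact h.convex_acceptance
  · refine convex_iff_forall_pos.2 fun X hX Y hY a b ha hb _ => ?_
    exact hsub _ _ ⟨0, hpos.smul_acceptance_mem hX ha, 0, hpos.smul_acceptance_mem hY hb,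
      add_zero 0⟩

end Acceptance

/-! ### The convex duality. -/

section Convex

variable {Ω : Type*} [m0 : MeasurableSpace Ω] {d : ℕ} {p q : ℝ≥0∞} {P : Measure Ω}
  {𝓕 : Filtration ℕ m0} {T t : ℕ} [Fact (1 ≤ p)] [Fact (1 ≤ q)] [ENNReal.HolderConjugate p q]
  {M : Submodule ℝ (RV d p P)} {R : RV d p P → Set (RV d p P)}

lemma IsCondRiskMeasure.exists_separating [IsProbabilityMeasure P] (hM : IsEligible (𝓕 t) M)
    (htT : t ≤ T) (h𝓕T : 𝓕 T = m0)
    (hR : IsCondRiskMeasure (M : Set (RV d p P)) R) (hc : HasClosedGraph (M : Set (RV d p P)) R)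
    (hA : Convex ℝ (acceptance R)) {X : RV d p P} (hX : X ∉ acceptance R) :
    ∃ z ∈ dualVars 𝓕 T t q (M : Set (RV d p P)), ∃ c : ℝ, dualEval p 𝓕 T t z X < c ∧
      ∀ Z ∈ acceptance R, c ≤ dualEval p 𝓕 T t z Z := by
  obtain ⟨m, hm, hmA⟩ := hR.exists_mem_acceptance
  obtain ⟨u, hu, huA⟩ := hR.exists_notMem_acceptance
  exact exists_dualVar_separating hM htT h𝓕T hA (isClosed_acceptance hc) hR.acceptance_add_mem
    hm hmA hu huA hX

lemma isPenalty_minPenalty [IsProbabilityMeasure P] (hM : IsEligible (𝓕 t) M)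
    (htT : t ≤ T) (h𝓕T : 𝓕 T = m0)
    (hR : IsCondRiskMeasure (M : Set (RV d p P)) R) (hc : HasClosedGraph (M : Set (RV d p P)) R)
    (hA : Convex ℝ (acceptance R)) :
    IsPenalty 𝓕 T t (M : Set (RV d p P)) (minPenalty 𝓕 T t (M : Set (RV d p P)) R :
      (Fin d → Measure Ω) × RV d q P → Set (RV d p P)) where
  mem z hz := by
    rw [minPenalty_eq hM htT hz]
    exact boundSet_mem_closedConvexUpperSets hM hz
  nonempty_iInter := by
    obtain ⟨m, hm, hmA⟩ := hR.exists_mem_acceptance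
    refine ⟨m, Set.mem_iInter₂.2 fun z hz => ?_⟩
    rw [minPenalty_eq hM htT hz]
    exact ⟨hm, fun b hb => hb ⟨m, hmA, rfl⟩⟩
  exists_ne := by
    obtain ⟨u, hu, huA⟩ := hR.exists_notMem_acceptance
    obtain ⟨z, hz, c, hlt, hle⟩ := hR.exists_separating (q := q) hM htT h𝓕T hc hA huA
    refine ⟨z, hz, fun h => ?_⟩
    rw [minPenalty_eq hM htT hz] at h
    have h1 : u ∈ boundSet 𝓕 T t M z (lowerBounds (dualEval p 𝓕 T t z '' acceptance R)) := by
      rw [h]; exact hu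
    refine absurd (h1.2 c ?_) (not_le.2 hlt)
    rintro _ ⟨Z, hZ, rfl⟩
    exact hle Z hZ
  eq_cl z hz := by
    rw [minPenalty_eq hM htT hz]
    exact boundSet_eq_cl hM htT hz

lemma oneSub_pos [IsFiniteMeasure P] {l : Lp ℝ ∞ P} (hl : ∀ᵐ ω ∂P, 0 < l ω ∧ l ω < 1) :
    ∀ᵐ ω ∂P, 0 < oneSub l ω := by
  filter_upwards [hl, oneSub_coe l] with ω h1 h2
  rw [h2]; linarith

/-- Conditional convexity puts `l Z + (1 - l) Z'` in the acceptance set, and the functional of `z`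
at `l Z` is that of `(Q, l w)` at `Z`. Taking the bound over `Z` and then over `Z'` adds two infima
without any arithmetic with infinite values. -/
lemma isCondPenalty_minPenalty [IsProbabilityMeasure P] (hM : IsEligible (𝓕 t) M)
    (htT : t ≤ T) (hR : IsCondConvex (𝓕 t) R) :
    IsCondPenalty 𝓕 T t (M : Set (RV d p P)) (minPenalty 𝓕 T t (M : Set (RV d p P)) R :
      (Fin d → Measure Ω) × RV d q P → Set (RV d p P)) := by
  rintro z hz l hl hl01 _ ⟨_, ⟨u, hu, rfl⟩, _, ⟨v, hv, rfl⟩, rfl⟩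
  have hl0 : ∀ᵐ ω ∂P, 0 < l ω := hl01.mono fun ω h => h.1
  have hl1 := oneSub_pos hl01
  have hl' := oneSub_mem_LInf hl
  have hz1 := (lmul_mem_dualVars hM hl hl0 hz).1
  have hz2 := (lmul_mem_dualVars hM hl' hl1 hz).1
  rw [minPenalty_eq hM htT hz1] at hu
  rw [minPenalty_eq hM htT hz2] at hv
  rw [minPenalty_eq hM htT hz]
  refine ⟨M.add_mem (hM.lmul_mem l hl u hu.1) (hM.lmul_mem _ hl' v hv.1), fun b hb => ?_⟩
  have hbound : ∀ Z ∈ acceptance R, ∀ Z' ∈ acceptance R,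
      b ≤ dualEval p 𝓕 T t z (lmul l Z) + dualEval p 𝓕 T t z (lmul (oneSub l) Z') := by
    intro Z hZ Z' hZ'
    rw [← map_add]
    exact hb ⟨_, hR.acceptance_mem hZ hZ' hl (hl01.mono fun ω h => ⟨h.1.le, h.2.le⟩), rfl⟩
  have h1 : ∀ Z' ∈ acceptance R, b - dualEval p 𝓕 T t z (lmul (oneSub l) Z') ≤
      dualEval p 𝓕 T t z (lmul l u) := by
    intro Z' hZ'
    rw [← dualEval_lmul hM hl hl0 hz]
    refine hu.2 _ ?_
    rintro _ ⟨Z, hZ, rfl⟩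
    rw [dualEval_lmul hM hl hl0 hz]
    linarith [hbound Z hZ Z' hZ']
  have h2 : b - dualEval p 𝓕 T t z (lmul l u) ≤ dualEval p 𝓕 T t z (lmul (oneSub l) v) := by
    rw [← dualEval_lmul hM hl' hl1 hz]
    refine hv.2 _ ?_
    rintro _ ⟨Z', hZ', rfl⟩
    rw [dualEval_lmul hM hl' hl1 hz]
    linarith [h1 Z' hZ']
  rw [map_add]
  linarith

lemma convexDualRep_minPenalty [IsProbabilityMeasure P] (hM : IsEligible (𝓕 t) M)
    (htT : t ≤ T) (h𝓕T : 𝓕 T = m0)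
    (hR : IsCondRiskMeasure (M : Set (RV d p P)) R) (hc : HasClosedGraph (M : Set (RV d p P)) R)
    (hA : Convex ℝ (acceptance R)) :
    ConvexDualRep 𝓕 T t (M : Set (RV d p P)) R (minPenalty 𝓕 T t (M : Set (RV d p P)) R :
      (Fin d → Measure Ω) × RV d q P → Set (RV d p P)) := by
  intro X
  have hterm : ∀ z ∈ dualVars 𝓕 T t q (M : Set (RV d p P)),
      minPenalty 𝓕 T t (M : Set (RV d p P)) R z + dualFun 𝓕 T t (M : Set (RV d p P)) z (-X) =
        {u | u ∈ M ∧ ∀ b ∈ lowerBounds (dualEval p 𝓕 T t z '' acceptance R),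
          b ≤ dualEval p 𝓕 T t z (X + u)} := fun z hz => by
    rw [minPenalty_eq hM htT hz, boundSet_add_dualFun hM htT hz]
  ext u
  rw [hR.mem_iff, Set.mem_iInter₂]
  constructor
  · rintro ⟨hu, huA⟩ z hz
    rw [hterm z hz]
    exact ⟨hu, fun b hb => hb ⟨_, huA, rfl⟩⟩
  · intro h
    -- Some dual variable must exist for membership in the intersection to imply `u ∈ M`.
    obtain ⟨z₀, hz₀, -⟩ := (isPenalty_minPenalty (q := q) hM htT h𝓕T hR hc hA).exists_ne
    have hu := h z₀ hz₀
    rw [hterm z₀ hz₀] at hu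
    refine ⟨hu.1, ?_⟩
    by_contra hX
    obtain ⟨z, hz, c, hlt, hle⟩ := hR.exists_separating (q := q) hM htT h𝓕T hc hA hX
    have hu := h z hz
    rw [hterm z hz] at hu
    refine absurd (hu.2 c ?_) (not_le.2 hlt)
    rintro _ ⟨Z, hZ, rfl⟩
    exact hle Z hZ

/-- The risk measure given by a penalty function. -/
lemma riskMeasure_of_penalty [IsFiniteMeasure P] (hM : IsEligible (𝓕 t) M) (htT : t ≤ T)
    (hRG : ∀ X, R X ∈ closedConvexUpperSets (M : Set (RV d p P)))
    {a : (Fin d → Measure Ω) × RV d q P → Set (RV d p P)}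
    (ha : IsPenalty 𝓕 T t (M : Set (RV d p P)) a)
    (hac : IsCondPenalty 𝓕 T t (M : Set (RV d p P)) a)
    (hrep : ConvexDualRep 𝓕 T t (M : Set (RV d p P)) R a) :
    IsCondRiskMeasure (M : Set (RV d p P)) R ∧ HasClosedGraph (M : Set (RV d p P)) R ∧
      IsCondConvex (𝓕 t) R := by
  have haB : ∀ z ∈ dualVars 𝓕 T t q (M : Set (RV d p P)),
      a z = boundSet 𝓕 T t M z (lowerBounds (dualEval p 𝓕 T t z '' a z)) := fun z hz =>
    penalty_eq_boundSet hM htT hz (ha.mem z hz) (ha.eq_cl z hz)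
  have hform : ∀ X u, u ∈ R X ↔ u ∈ M ∧ ∀ z ∈ dualVars 𝓕 T t q (M : Set (RV d p P)),
      ∀ b ∈ lowerBounds (dualEval p 𝓕 T t z '' a z), b ≤ dualEval p 𝓕 T t z (X + u) := by
    intro X u
    rw [hrep X, Set.mem_iInter₂]
    have hterm : ∀ z ∈ dualVars 𝓕 T t q (M : Set (RV d p P)),
        (u ∈ a z + dualFun 𝓕 T t (M : Set (RV d p P)) z (-X) ↔ u ∈ M ∧
          ∀ b ∈ lowerBounds (dualEval p 𝓕 T t z '' a z), b ≤ dualEval p 𝓕 T t z (X + u)) := by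
      intro z hz
      nth_rewrite 1 [haB z hz]
      rw [boundSet_add_dualFun hM htT hz]
      rfl
    obtain ⟨z₀, hz₀, -⟩ := ha.exists_ne
    exact ⟨fun h => ⟨((hterm z₀ hz₀).1 (h z₀ hz₀)).1, fun z hz => ((hterm z hz).1 (h z hz)).2⟩,
      fun h z hz => (hterm z hz).2 ⟨h.1, h.2 z hz⟩⟩
  have h0 : R 0 ≠ ∅ := by
    obtain ⟨m, hm⟩ := ha.nonempty_iInter
    rw [Set.mem_iInter₂] at hm
    refine Set.nonempty_iff_ne_empty.1 ⟨m, (hform 0 m).2 ⟨?_, fun z hz b hb => ?_⟩⟩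
    · obtain ⟨z₀, hz₀, -⟩ := ha.exists_ne
      exact (ha.mem z₀ hz₀).1 (hm z₀ hz₀)
    · rw [zero_add]
      exact hb ⟨m, hm z hz, rfl⟩
  have h1 : R 0 ≠ M := by
    intro h
    obtain ⟨z₀, hz₀, hne⟩ := ha.exists_ne
    refine hne (Set.Subset.antisymm (ha.mem z₀ hz₀).1 fun u hu => ?_)
    rw [← h] at hu
    rw [haB z₀ hz₀]
    refine ⟨((hform 0 u).1 hu).1, fun b hb => ?_⟩
    have := ((hform 0 u).1 hu).2 z₀ hz₀ b hb
    rwa [zero_add] at this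
  obtain ⟨hrisk, hclosed⟩ := isCondRiskMeasure_of_bounds hM (fun _ h => h) hform hRG h0 h1
  refine ⟨hrisk, hclosed, ?_⟩
  -- For strict weights, `X` is tested with `(Q, l w)` and `Y` with `(Q, (1 - l) w)`; the penalty
  -- inequality then combines the two decompositions into one for `(Q, w)`.
  have hstrict : ∀ X Y u v, u ∈ R X → v ∈ R Y → ∀ l ∈ LInf (𝓕 t) P,
      (∀ᵐ ω ∂P, 0 < l ω ∧ l ω < 1) →
      lmul l u + lmul (oneSub l) v ∈ R (lmul l X + lmul (oneSub l) Y) := by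
    intro X Y u v hu hv l hl hl01
    have hl0 : ∀ᵐ ω ∂P, 0 < l ω := hl01.mono fun ω h => h.1
    have hl1 := oneSub_pos hl01
    have hl' := oneSub_mem_LInf hl
    rw [hrep, Set.mem_iInter₂] at hu hv ⊢
    intro z hz
    have hz1 := (lmul_mem_dualVars hM hl hl0 hz).1
    have hz2 := (lmul_mem_dualVars hM hl' hl1 hz).1
    obtain ⟨u1, hu1, u2, hu2, rfl⟩ := hu _ hz1
    obtain ⟨v1, hv1, v2, hv2, rfl⟩ := hv _ hz2
    rw [mem_dualFun hM htT hz1, dualEval_lmul hM hl hl0 hz, dualEval_lmul hM hl hl0 hz] at hu2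
    rw [mem_dualFun hM htT hz2, dualEval_lmul hM hl' hl1 hz, dualEval_lmul hM hl' hl1 hz] at hv2
    refine ⟨lmul l u1 + lmul (oneSub l) v1, hac z hz l hl hl01
      ⟨_, ⟨u1, hu1, rfl⟩, _, ⟨v1, hv1, rfl⟩, rfl⟩, lmul l u2 + lmul (oneSub l) v2, ?_, ?_⟩
    · rw [mem_dualFun hM htT hz]
      refine ⟨M.add_mem (hM.lmul_mem l hl _ hu2.1) (hM.lmul_mem _ hl' _ hv2.1), ?_⟩
      have h1 := hu2.2
      have h2 := hv2.2
      rw [lmul_neg, map_neg] at h1 h2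
      rw [map_neg, map_add, map_add]
      linarith
    · simp only [lmul_add]
      abel
  rintro X Y l hl hl01 _ ⟨_, ⟨u, hu, rfl⟩, _, ⟨v, hv, rfl⟩, rfl⟩
  have huM := ((hform X u).1 hu).1
  have hvM := ((hform Y v).1 hv).1
  refine (hform _ _).2 ⟨M.add_mem (hM.lmul_mem l hl u huM)
    (hM.lmul_mem _ (oneSub_mem_LInf hl) v hvM), fun z hz b hb => ?_⟩
  -- A weight between 0 and 1 is approximated by `(1 - ε) l + ε / 2`, which lies strictly between.
  -- The combination is affine in `ε`, so each scalar bound passes to the limit.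
  have hcomb : ∀ (ε : ℝ) (x y : RV d p P),
      lmul ((1 - ε) • l + (ε / 2) • Lp.const ∞ P (1 : ℝ)) x +
        lmul (oneSub ((1 - ε) • l + (ε / 2) • Lp.const ∞ P (1 : ℝ))) y =
      (lmul l x + lmul (oneSub l) y) +
        ε • ((1 / 2 : ℝ) • (x + y) - (lmul l x + lmul (oneSub l) y)) := by
    intro ε x y
    simp only [oneSub_lmul, add_lmul, smul_lmul, lmul_const]
    module
  refine le_of_forall_small_le (c := dualEval p 𝓕 T t z
    (((1 / 2 : ℝ) • (X + Y) - (lmul l X + lmul (oneSub l) Y)) +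
      ((1 / 2 : ℝ) • (u + v) - (lmul l u + lmul (oneSub l) v)))) fun ε hε hε1 => ?_
  have h := hstrict X Y u v hu hv ((1 - ε) • l + (ε / 2) • Lp.const ∞ P (1 : ℝ))
    (add_mem_LInf (smul_mem_LInf hl _) (smul_mem_LInf (const_mem_LInf 1) _)) (by
      filter_upwards [hl01, Lp.coeFn_add ((1 - ε) • l) ((ε / 2) • Lp.const ∞ P (1 : ℝ)),
        Lp.coeFn_smul (1 - ε) l, Lp.coeFn_smul (ε / 2) (Lp.const ∞ P (1 : ℝ)),
        Lp.coeFn_const (p := ∞) (μ := P) (1 : ℝ)] with ω h1 h2 h3 h4 h5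
      rw [h2, Pi.add_apply, h3, h4, Pi.smul_apply, Pi.smul_apply, h5]
      simp only [Function.const_apply, smul_eq_mul, mul_one]
      constructor <;> nlinarith [h1.1, h1.2])
  rw [hcomb, hcomb] at h
  have h2 := ((hform _ _).1 h).2 z hz b hb
  simp only [map_add, map_sub, map_smul, smul_eq_mul] at h2 ⊢
  linarith

end Convex

/-! ### The coherent duality. -/

section Coherent

variable {Ω : Type*} [m0 : MeasurableSpace Ω] {d : ℕ} {p q : ℝ≥0∞} {P : Measure Ω}
  {𝓕 : Filtration ℕ m0} {T t : ℕ} [Fact (1 ≤ p)] [Fact (1 ≤ q)] [ENNReal.HolderConjugate p q]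
  {M : Submodule ℝ (RV d p P)} {R : RV d p P → Set (RV d p P)}
  {z : (Fin d → Measure Ω) × RV d q P}

lemma mem_maxDualSet : z ∈ maxDualSet 𝓕 T t q (M : Set (RV d p P)) R ↔
    z ∈ dualVars 𝓕 T t q (M : Set (RV d p P)) ∧
      ∀ X ∈ acceptance R, 0 ≤ dualEval p 𝓕 T t z X := by
  refine and_congr_right fun hz => forall₂_congr fun X _ => ?_
  rw [pairing_dualDensity hz, dualEval_apply]

/-- The risk measure given by a conditionally conical set of dual variables. -/
lemma riskMeasure_of_dualSet [IsFiniteMeasure P] (hM : IsEligible (𝓕 t) M) (htT : t ≤ T)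
    (hRG : ∀ X, R X ∈ closedConvexUpperSets (M : Set (RV d p P)))
    {W : Set ((Fin d → Measure Ω) × RV d q P)} (hne : W.Nonempty)
    (hW : W ⊆ dualVars 𝓕 T t q (M : Set (RV d p P))) (hcon : IsCondConical (𝓕 t) W)
    (hrep : CoherentDualRep 𝓕 T t (M : Set (RV d p P)) R W) :
    IsCondRiskMeasure (M : Set (RV d p P)) R ∧ HasClosedGraph (M : Set (RV d p P)) R ∧
      IsCondCoherent (𝓕 t) R := by
  obtain ⟨z₀, hz₀⟩ := hne
  have hmem : ∀ X u, u ∈ R X ↔ u ∈ M ∧ ∀ z ∈ W, 0 ≤ dualEval p 𝓕 T t z (X + u) := by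
    intro X u
    rw [hrep X, Set.mem_iInter₂]
    have hterm : ∀ z ∈ W, (u ∈ dualFun 𝓕 T t (M : Set (RV d p P)) z (-X) ↔
        u ∈ M ∧ 0 ≤ dualEval p 𝓕 T t z (X + u)) := by
      intro z hz
      rw [mem_dualFun hM htT (hW hz), map_neg, map_add, neg_le_iff_add_nonneg']
    exact ⟨fun h => ⟨((hterm z₀ hz₀).1 (h z₀ hz₀)).1, fun z hz => ((hterm z hz).1 (h z hz)).2⟩,
      fun h z hz => (hterm z hz).2 ⟨h.1, h.2 z hz⟩⟩
  have h0 : R 0 ≠ ∅ := Set.nonempty_iff_ne_empty.1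
    ⟨0, (hmem 0 0).2 ⟨M.zero_mem, fun z _ => by rw [add_zero, map_zero]⟩⟩
  have h1 : R 0 ≠ M := by
    intro h
    obtain ⟨v, hv, hpos⟩ := exists_dualEval_pos hM htT (hW hz₀)
    have hv' : -v ∈ R 0 := by rw [h]; exact M.neg_mem hv
    have := ((hmem 0 (-v)).1 hv').2 z₀ hz₀
    rw [zero_add, map_neg] at this
    linarith
  obtain ⟨hrisk, hclosed⟩ := isCondRiskMeasure_of_bounds (B := fun _ => {0}) hM hW
    (fun X u => by rw [hmem]; simp) hRG h0 h1
  refine ⟨hrisk, hclosed, Or.inr ⟨?_, fun X l hl => ?_⟩⟩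
  · rintro X Y _ ⟨u, hu, v, hv, rfl⟩
    rw [hmem] at hu hv ⊢
    refine ⟨M.add_mem hu.1 hv.1, fun z hz => ?_⟩
    have h1 := hu.2 z hz
    have h2 := hv.2 z hz
    simp only [map_add] at h1 h2 ⊢
    linarith
  · obtain ⟨k, hk, hkl, hlk⟩ := exists_LInfPos_inv (d := d) (p := p) (𝓕.le t) hl
    have hdual : ∀ (j : Lp ℝ ∞ P), j ∈ LInfPos (𝓕 t) P → ∀ Y v, v ∈ R Y →
        lmul j v ∈ R (lmul j Y) := by
      intro j hj Y v hv
      rw [hmem] at hv ⊢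
      refine ⟨hM.lmul_mem j hj.1 v hv.1, fun z hz => ?_⟩
      rw [← lmul_add, ← dualEval_lmul hM hj.1 (LInfPos_pos hj) (hW hz)]
      exact hv.2 _ (hcon z hz j hj)
    refine Set.Subset.antisymm (fun u hu => ⟨lmul k u, ?_, hlk u⟩) ?_
    · have := hdual k hk _ _ hu
      rwa [hkl] at this
    · rintro _ ⟨u, hu, rfl⟩
      exact hdual l hl X u hu

/-- Homogeneity covers only uniformly positive scalars. It is applied to `l + ε`, and closedness of
the acceptance set gives `l X` as `ε → 0`. -/
lemma lmul_mem_maxDualSet [IsFiniteMeasure P] (hM : IsEligible (𝓕 t) M)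
    (hc : HasClosedGraph (M : Set (RV d p P)) R) (hpos : IsCondPosHomogeneous (𝓕 t) R)
    (hz : z ∈ maxDualSet 𝓕 T t q (M : Set (RV d p P)) R) {l : Lp ℝ ∞ P} (hl : l ∈ LInf (𝓕 t) P)
    (hl0 : ∀ᵐ ω ∂P, 0 < l ω) :
    (z.1, lmul l z.2) ∈ maxDualSet 𝓕 T t q (M : Set (RV d p P)) R := by
  rw [mem_maxDualSet] at hz ⊢
  refine ⟨(lmul_mem_dualVars hM hl hl0 hz.1).1, fun X hX => ?_⟩
  rw [dualEval_lmul hM hl hl0 hz.1]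
  refine hz.2 _ (mem_of_forall_add_smul_mem (isClosed_acceptance hc) (v := X) fun ε hε _ => ?_)
  have hlε : l + Lp.const ∞ P ε ∈ LInfPos (𝓕 t) P := by
    refine ⟨add_mem_LInf hl (const_mem_LInf ε), ε, hε, ?_⟩
    filter_upwards [hl0, Lp.coeFn_add l (Lp.const ∞ P ε), Lp.coeFn_const (p := ∞) (μ := P) ε]
      with ω h1 h2 h3
    rw [h2, Pi.add_apply, h3]
    simpa using h1.le
  have := hpos.lmul_acceptance_mem hX hlε
  rwa [add_lmul, lmul_const] at this

variable [IsProbabilityMeasure P] (hM : IsEligible (𝓕 t) M) (htT : t ≤ T) (h𝓕T : 𝓕 T = m0)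
  (hR : IsCondRiskMeasure (M : Set (RV d p P)) R) (hc : HasClosedGraph (M : Set (RV d p P)) R)
  (hcoh : IsCondCoherent (𝓕 t) R)
include hM htT h𝓕T hR hc hcoh

/-- A functional bounded below on a cone is nonnegative there, so the separating level can be taken
to be 0 and the separating dual variable belongs to the maximal set. -/
lemma exists_mem_maxDualSet {X : RV d p P} (hX : X ∉ acceptance R) :
    ∃ z ∈ maxDualSet 𝓕 T t q (M : Set (RV d p P)) R, dualEval p 𝓕 T t z X < 0 := by
  have hpos := hcoh.isCondPosHomogeneous
  obtain ⟨z, hz, c, hlt, hle⟩ := hR.exists_separating (q := q) hM htT h𝓕T hc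
    hcoh.convex_acceptance hX
  obtain ⟨m, -, hmA⟩ := hR.exists_mem_acceptance
  have hray : ∀ Z ∈ acceptance R, ∀ r : ℝ, 0 < r → c ≤ r * dualEval p 𝓕 T t z Z := by
    intro Z hZ r hr
    have := hle _ (hpos.smul_acceptance_mem hZ hr)
    rwa [map_smul, smul_eq_mul] at this
  have hc0 : c ≤ 0 := le_of_forall_small_le (c := dualEval p 𝓕 T t z m) fun ε hε _ => by
    rw [zero_add]; exact hray m hmA ε hε
  refine ⟨z, mem_maxDualSet.2 ⟨hz, fun Z hZ => ?_⟩, hlt.trans_le hc0⟩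
  by_contra hneg
  rw [not_le] at hneg
  -- Scaling `Z` by this factor brings the functional to `c - 1`, below its bound; positivity of the
  -- factor uses `c ≤ 0`.
  have h1 := hray Z hZ ((c - 1) / dualEval p 𝓕 T t z Z) (div_pos_of_neg_of_neg (by linarith) hneg)
  rw [div_mul_cancel₀ _ hneg.ne] at h1
  linarith

lemma maxDualSet_nonempty : (maxDualSet 𝓕 T t q (M : Set (RV d p P)) R).Nonempty := by
  obtain ⟨u, -, huA⟩ := hR.exists_notMem_acceptance
  obtain ⟨z, hz, -⟩ := exists_mem_maxDualSet (q := q) hM htT h𝓕T hR hc hcoh huA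
  exact ⟨z, hz⟩

lemma coherentDualRep_maxDualSet : CoherentDualRep 𝓕 T t (M : Set (RV d p P)) R
    (maxDualSet 𝓕 T t q (M : Set (RV d p P)) R) := by
  intro X
  have hterm : ∀ z ∈ maxDualSet 𝓕 T t q (M : Set (RV d p P)) R, ∀ u,
      (u ∈ dualFun 𝓕 T t (M : Set (RV d p P)) z (-X) ↔
        u ∈ M ∧ 0 ≤ dualEval p 𝓕 T t z (X + u)) := by
    intro z hz u
    rw [mem_dualFun hM htT hz.1, map_neg, map_add, neg_le_iff_add_nonneg']
  ext u
  rw [hR.mem_iff, Set.mem_iInter₂]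
  constructor
  · rintro ⟨hu, huA⟩ z hz
    exact (hterm z hz u).2 ⟨hu, (mem_maxDualSet.1 hz).2 _ huA⟩
  · intro h
    obtain ⟨z₀, hz₀⟩ := maxDualSet_nonempty (q := q) hM htT h𝓕T hR hc hcoh
    refine ⟨((hterm z₀ hz₀ u).1 (h z₀ hz₀)).1, ?_⟩
    by_contra hX
    obtain ⟨z, hz, hlt⟩ := exists_mem_maxDualSet (q := q) hM htT h𝓕T hR hc hcoh hX
    exact absurd ((hterm z hz u).1 (h z hz)).2 (not_le.2 hlt)

end Coherent

/-! ### The properties of the minimal penalty and of the maximal dual set. -/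

section Summary

variable {Ω : Type*} [m0 : MeasurableSpace Ω] {d : ℕ} {p q : ℝ≥0∞} {P : Measure Ω}
  [IsProbabilityMeasure P] {𝓕 : Filtration ℕ m0} {T t : ℕ} [Fact (1 ≤ p)] [Fact (1 ≤ q)]
  [ENNReal.HolderConjugate p q] {M : Submodule ℝ (RV d p P)} {R : RV d p P → Set (RV d p P)}

lemma minPenalty_properties (hM : IsEligible (𝓕 t) M) (htT : t ≤ T) (h𝓕T : 𝓕 T = m0)
    (h : IsCondRiskMeasure (M : Set (RV d p P)) R ∧ HasClosedGraph (M : Set (RV d p P)) R ∧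
      IsCondConvex (𝓕 t) R) :
    IsPenalty 𝓕 T t (M : Set (RV d p P)) (minPenalty 𝓕 T t (M : Set (RV d p P)) R :
        (Fin d → Measure Ω) × RV d q P → Set (RV d p P)) ∧
      IsCondPenalty 𝓕 T t (M : Set (RV d p P)) (minPenalty 𝓕 T t (M : Set (RV d p P)) R :
        (Fin d → Measure Ω) × RV d q P → Set (RV d p P)) ∧
      ConvexDualRep 𝓕 T t (M : Set (RV d p P)) R (minPenalty 𝓕 T t (M : Set (RV d p P)) R :
        (Fin d → Measure Ω) × RV d q P → Set (RV d p P)) := by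
  obtain ⟨h1, h2, h3⟩ := h
  exact ⟨isPenalty_minPenalty hM htT h𝓕T h1 h2 h3.convex_acceptance,
    isCondPenalty_minPenalty hM htT h3,
    convexDualRep_minPenalty hM htT h𝓕T h1 h2 h3.convex_acceptance⟩

lemma maxDualSet_properties (hM : IsEligible (𝓕 t) M) (htT : t ≤ T) (h𝓕T : 𝓕 T = m0)
    (h : IsCondRiskMeasure (M : Set (RV d p P)) R ∧ HasClosedGraph (M : Set (RV d p P)) R ∧
      IsCondCoherent (𝓕 t) R) :
    (maxDualSet 𝓕 T t q (M : Set (RV d p P)) R).Nonempty ∧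
      IsCondConical (𝓕 t) (maxDualSet 𝓕 T t q (M : Set (RV d p P)) R) ∧
      (∀ z ∈ maxDualSet 𝓕 T t q (M : Set (RV d p P)) R, ∀ l ∈ LInf (𝓕 t) P,
        (∀ᵐ ω ∂P, 0 < l ω) →
          (z.1, lmul l z.2) ∈ maxDualSet 𝓕 T t q (M : Set (RV d p P)) R) ∧
      CoherentDualRep 𝓕 T t (M : Set (RV d p P)) R
        (maxDualSet 𝓕 T t q (M : Set (RV d p P)) R) := by
  obtain ⟨h1, h2, h3⟩ := h
  have hmul : ∀ z ∈ maxDualSet 𝓕 T t q (M : Set (RV d p P)) R, ∀ l ∈ LInf (𝓕 t) P,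
      (∀ᵐ ω ∂P, 0 < l ω) → (z.1, lmul l z.2) ∈ maxDualSet 𝓕 T t q (M : Set (RV d p P)) R :=
    fun z hz l hl hl0 => lmul_mem_maxDualSet hM h2 h3.isCondPosHomogeneous hz hl hl0
  exact ⟨maxDualSet_nonempty hM htT h𝓕T h1 h2 h3,
    fun z hz l hl => hmul z hz l hl.1 (LInfPos_pos hl), hmul,
    coherentDualRep_maxDualSet hM htT h𝓕T h1 h2 h3⟩

end Summary

end SetRisk

end

theorem mainTheorem4 {Ω : Type*} [m0 : MeasurableSpace Ω] (P : Measure Ω) [IsProbabilityMeasure P]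
    (d T t : ℕ) (htT : t ≤ T) (𝓕 : Filtration ℕ m0) (h𝓕T : 𝓕 T = m0)
    (p q : ℝ≥0∞) [Fact (1 ≤ p)] [Fact (1 ≤ q)] [ENNReal.HolderConjugate p q]
    (Mtilde : Ω → Set (Fin d → ℝ))
    (hMtilde_meas : MeasurableSet[(𝓕 t).prod (inferInstance : MeasurableSpace (Fin d → ℝ))]
      {z : Ω × (Fin d → ℝ) | z.2 ∈ Mtilde z.1})
    (hMtilde_sub : ∀ᵐ ω ∂P, ∃ V : Submodule ℝ (Fin d → ℝ), Mtilde ω = (V : Set (Fin d → ℝ)))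
    (M : Set (SetRisk.RV d p P)) (hM : M = SetRisk.eligible (𝓕 t) Mtilde p P)
    (hM_nontrivial : SetRisk.nonneg M ≠ {0})
    (R : SetRisk.RV d p P → Set (SetRisk.RV d p P))
    (hR : ∀ X, R X ∈ SetRisk.closedConvexUpperSets M) :
    ((SetRisk.IsCondRiskMeasure M R ∧ SetRisk.HasClosedGraph M R ∧
          SetRisk.IsCondConvex (𝓕 t) R) ↔
        ∃ a : (Fin d → Measure Ω) × SetRisk.RV d q P → Set (SetRisk.RV d p P),
          SetRisk.IsPenalty 𝓕 T t M a ∧ SetRisk.IsCondPenalty 𝓕 T t M a ∧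
            SetRisk.ConvexDualRep 𝓕 T t M R a) ∧
    ((SetRisk.IsCondRiskMeasure M R ∧ SetRisk.HasClosedGraph M R ∧
          SetRisk.IsCondConvex (𝓕 t) R) →
        SetRisk.IsPenalty 𝓕 T t M
            (SetRisk.minPenalty 𝓕 T t M R :
              (Fin d → Measure Ω) × SetRisk.RV d q P → Set (SetRisk.RV d p P)) ∧
          SetRisk.IsCondPenalty 𝓕 T t M
            (SetRisk.minPenalty 𝓕 T t M R :
              (Fin d → Measure Ω) × SetRisk.RV d q P → Set (SetRisk.RV d p P)) ∧
          SetRisk.ConvexDualRep 𝓕 T t M R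
            (SetRisk.minPenalty 𝓕 T t M R :
              (Fin d → Measure Ω) × SetRisk.RV d q P → Set (SetRisk.RV d p P))) ∧
    ((SetRisk.IsCondRiskMeasure M R ∧ SetRisk.HasClosedGraph M R ∧
          SetRisk.IsCondCoherent (𝓕 t) R) ↔
        ∃ W : Set ((Fin d → Measure Ω) × SetRisk.RV d q P),
          W.Nonempty ∧ W ⊆ SetRisk.dualVars 𝓕 T t q M ∧ SetRisk.IsCondConical (𝓕 t) W ∧
            SetRisk.CoherentDualRep 𝓕 T t M R W) ∧
    ((SetRisk.IsCondRiskMeasure M R ∧ SetRisk.HasClosedGraph M R ∧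
          SetRisk.IsCondCoherent (𝓕 t) R) →
        (SetRisk.maxDualSet 𝓕 T t q M R).Nonempty ∧
          SetRisk.IsCondConical (𝓕 t) (SetRisk.maxDualSet 𝓕 T t q M R) ∧
          (∀ z ∈ SetRisk.maxDualSet 𝓕 T t q M R, ∀ l ∈ SetRisk.LInf (𝓕 t) P,
            (∀ᵐ ω ∂P, 0 < l ω) →
              (z.1, SetRisk.lmul l z.2) ∈ SetRisk.maxDualSet 𝓕 T t q M R) ∧
          SetRisk.CoherentDualRep 𝓕 T t M R (SetRisk.maxDualSet 𝓕 T t q M R)) := by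
  have h𝓕t : 𝓕 t ≤ m0 := 𝓕.le t
  obtain ⟨V, hV, hE⟩ : ∃ V : Submodule ℝ (SetRisk.RV d p P),
      M = (V : Set (SetRisk.RV d p P)) ∧ SetRisk.IsEligible (𝓕 t) V :=
    ⟨SetRisk.eligibleSubmodule (𝓕 t) p P hMtilde_sub, hM,
      ⟨fun _ hu => hu.1, fun _ hl _ hu => SetRisk.lmul_mem_eligible hMtilde_sub hl hu,
        SetRisk.isClosed_eligible h𝓕t hMtilde_sub⟩⟩
  clear hM
  subst hV
  have hconv := SetRisk.minPenalty_properties (q := q) (R := R) hE htT h𝓕T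
  have hcoh := SetRisk.maxDualSet_properties (q := q) (R := R) hE htT h𝓕T
  refine ⟨⟨fun h => ⟨_, hconv h⟩, fun ⟨a, ha, hac, hrep⟩ =>
    SetRisk.riskMeasure_of_penalty hE htT hR ha hac hrep⟩, hconv,
    ⟨fun h => ⟨_, (hcoh h).1, fun z hz => hz.1, (hcoh h).2.1, (hcoh h).2.2.2⟩,
      fun ⟨W, hne, hW, hcon, hrep⟩ =>
        SetRisk.riskMeasure_of_dualSet hE htT hR hne hW hcon hrep⟩, hcoh⟩
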